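/- **Model.** Consider a network of controller–controlled-system pairs in $\mathbb R^2$, indexed by $i=0,1,2,\dots$, with the controlled system (actuator) of the typical pair $i=0$ at the origin. Its controller is at distance $r_0>0$ from the origin; the controllers $i\ge1$ form a homogeneous Poisson point process (PPP) $\Phi$ of intensity $\lambda>0$, and $r_i$ denotes the distance of controller $i$ from the origin. Time slots $t=0,1,2,\dots$ are grouped into blocks $\{kT,\dots,(k+1)T-1\}$ of length $T$. Under block ALOHA with parameter $q\in[0,1]$, each controller is, in each block, active during the whole block with probability $q$ and idle otherwise; $C_i(t)\in\{0,1\}$ denotes its state in slot $t$. The fading coefficients $h_i(t)$ are Rayleigh, with $|h_i(t)|^2$ exponential of mean $1$. The locations, all activity variables and all fading coefficients are independent. With path-loss exponent $\alpha>0$, path-loss constant $\rho>0$, transmit power $\eta>0$, noise power $N_0\ge0$ and threshold $\gamma>0$, put $$\xi(t)=\frac{\eta\rho|h_0(t)|^2r_0^{-\alpha}}{N_0+\sum_{i\ge1}C_i(t)\,\eta\rho|h_i(t)|^2r_i^{-\alpha}},\qquad S(t)=\mathbf 1\{C_0(t)\,\xi(t)>\gamma\},$$ where $\xi(t)=0$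 if the interference sum is infinite. The typical system is $\boldsymbol x(t+1)=\boldsymbol A\boldsymbol x(t)+\boldsymbol B\boldsymbol u(t)+\boldsymbol v(t)$ with $\boldsymbol A\in\mathbb R^{n\times n}$, $n\ge1$, $\boldsymbol B\in\mathbb R^{n\times m}$ and column space of $\boldsymbol I-\boldsymbol A$ contained in that of $\boldsymbol B$; $v$ is the degree of the minimal polynomial of $\boldsymbol A$. The (restless) system is *block controllable* in block $k$ if there is a run of at least $v$ ones in $S(kT),\dots,S((k+1)T-1)$. Given that the typical controller transmits in block $k$, let $\bar F_{\rm RL,blk}(v)$ be the conditional probability of block controllability, and $P_{\rm blk}$ the conditional probability that $S(t)=1$ for a slot $t$ of block $k$, both conditional on the locations of the controllers and on the activity in block $k$ of the controllers $i\ge1$. **Theorem.** For every block $k$, the probability $P_{\rm RL,blk}$ that the typical system is block controllable in block $k$ is $$P_{\rm RL,blk}=q\,\mathbb E\big[\bar F_{\rm RL,blk}(v)\big]=q\sum_{l=1}^{\lfloor\frac{T+1}{v+1}\rfloor}(-1)^{l+1}\binom{T-lv}{l-1}\Bigg(\sum_{j=0}^{l-1}\binom{l-1}{j}(-1)^j\zeta(lv+1+j)+\frac{T-lv+1}{l}\sum_{j=0}^{l}\binom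 lj(-1)^j\zeta(lv+j)\Bigg),$$ where, for integers $l\ge0$, $$\zeta(l)=e^{-\frac{\gamma N_0l}{\eta\rho r_0^{-\alpha}}}\exp\big(2\pi\lambda q\,I(l)\big),\qquad I(l)=\sum_{j=1}^{l}\binom lj\int_0^\infty\left(\frac{-\gamma z^{-\alpha}}{r_0^{-\alpha}+\gamma z^{-\alpha}}\right)^{j}z\,\mathrm dz .$$ Moreover, if $q>0$, then $\zeta(l)=\mathbb E[P_{\rm blk}^l]$ for all $l\ge0$ and for every slot $t$ of block $k$. If $\alpha>2$, then every $I(l)$ is a finite sum of finite integrals. For general $\alpha>0$ the integrals take values in $[-\infty,\infty]$, with the conventions that a sum with a term $-\infty$ is $-\infty$, that $\exp(-\infty)=0$ and that $0\cdot(\pm\infty)=0$. -/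

import Mathlib

open MeasureTheory ProbabilityTheory Set
open scoped ENNReal

namespace PoissonControl

/-- The Euclidean plane. -/
abbrev Plane : Type := EuclideanSpace ℝ (Fin 2)

/-! ### Restless systems -/

/-- A controlled linear system `x(t+1) = A x(t) + B u(t) + v(t)` with state in `ℝⁿ` and input in
`ℝᵐ`, such that the column space of `B` contains the column space of `1 - A`. -/
structure RestlessSystem (n m : ℕ) where
  A : Matrix (Fin n) (Fin n) ℝ
  B : Matrix (Fin n) (Fin m) ℝ
  range_le : LinearMap.range (1 - A).mulVecLin ≤ LinearMap.range B.mulVecLin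

/-- The number `v` of consecutive inputs needed: the degree of the minimal polynomial of `A`. -/
noncomputable def RestlessSystem.horizon {n m : ℕ} (R : RestlessSystem n m) : ℕ :=
  (minpoly ℝ R.A).natDegree

/-! ### Poisson point processes in the plane -/

/-- The number of indices `i` with `x i ω ∈ B`. -/
noncomputable def count {Ω : Type*} (x : ℕ → Ω → Plane) (B : Set Plane) (ω : Ω) : ℕ∞ :=
  {i | x i ω ∈ B}.encard

/-- The random points `x 0, x 1, …` enumerate a homogeneous Poisson point process of intensity
`lam` on the plane: numbers of points in bounded Borel sets are Poisson distributed, and numbers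
of points in pairwise disjoint bounded Borel sets are independent. -/
structure IsPoissonPointProcess {Ω : Type*} [MeasurableSpace Ω] (μ : Measure Ω) (lam : ℝ)
    (x : ℕ → Ω → Plane) : Prop where
  measurable : ∀ i, Measurable (x i)
  poisson : ∀ B : Set Plane, MeasurableSet B → Bornology.IsBounded B → ∀ n : ℕ,
    μ.real {ω | count x B ω = (n : ℕ∞)} =
      Real.exp (-(lam * volume.real B)) * (lam * volume.real B) ^ n / (n.factorial : ℝ)
  indep : ∀ (p : ℕ) (B : Fin p → Set Plane), (∀ j, MeasurableSet (B j)) →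
    (∀ j, Bornology.IsBounded (B j)) → Pairwise (fun j j' => Disjoint (B j) (B j')) →
    iIndepFun (fun j => count x (B j)) μ

/-! ### The network -/

/-- Parameters: density `lam` of the controllers, ALOHA parameter `q`, path-loss exponent `α`,
path-loss constant `ρ`, transmit power `η`, noise power `N₀`, SINR threshold `γ`, distance `r₀` of
the typical pair, and block length `T`. -/
structure Params where
  (lam q α ρ η N₀ γ r₀ : ℝ)
  T : ℕ

/-- The random elements of a network. Index `0` is the typical pair, whose controlled system is at
the origin. `pos i` is the location of the `i`th controller, `active i k` says whether the `i`th
controller is active in block `k`, and `fading i t` is the fading coefficient `h_i(t)` between the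
`i`th controller and the typical actuator in slot `t`. -/
structure Network (Ω : Type*) where
  pos : ℕ → Ω → Plane
  active : ℕ → ℕ → Ω → Bool
  fading : ℕ → ℕ → Ω → ℂ

namespace Network

variable {Ω : Type*} (N : Network Ω) (P : Params)

/-- The σ-algebras generated by, respectively, all the locations, each single activity indicator,
and each single fading coefficient. -/
noncomputable def sources : Unit ⊕ (ℕ × ℕ) ⊕ (ℕ × ℕ) → MeasurableSpace Ω
  | Sum.inl _ => ⨆ i, MeasurableSpace.comap (N.pos i) inferInstance
  | Sum.inr (Sum.inl (i, k)) => MeasurableSpace.comap (N.active i k) inferInstance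
  | Sum.inr (Sum.inr (i, t)) => MeasurableSpace.comap (N.fading i t) inferInstance

/-- The Poisson network under block ALOHA with Rayleigh fading: the typical controller is at
distance `r₀` from the origin, the other controllers form a Poisson point process of intensity
`lam`, every controller is active in a given block with probability `q`, every `|h_i(t)|²` is
exponential with mean `1`, and locations, activities and fadings are all independent. -/
structure IsBlockAloha [MeasurableSpace Ω] (μ : Measure Ω) : Prop where
  measurable_pos : ∀ i, Measurable (N.pos i)
  measurable_active : ∀ i k, Measurable (N.active i k)
  measurable_fading : ∀ i t, Measurable (N.fading i t)
  typical : ∀ ω, ‖N.pos 0 ω‖ = P.r₀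
  interferers : IsPoissonPointProcess μ P.lam (fun i => N.pos (i + 1))
  access : ∀ i k, μ.real {ω | N.active i k ω = true} = P.q
  rayleigh : ∀ i t, μ.map (fun ω => ‖N.fading i t ω‖ ^ 2) = expMeasure 1
  indep : iIndep N.sources μ

/-- The channel access state `C_i(t)`, constant on each block `{kT, …, (k+1)T - 1}`. -/
def access (i t : ℕ) (ω : Ω) : ℕ :=
  if N.active i (t / P.T) ω = true then 1 else 0

/-- The power `η ρ |h_i(t)|² r_i^{-α}` received at the typical actuator from controller `i`. -/
noncomputable def power (i t : ℕ) (ω : Ω) : ℝ≥0∞ :=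
  ENNReal.ofReal (P.η * P.ρ * ‖N.fading i t ω‖ ^ 2 * ‖N.pos i ω‖ ^ (-P.α))

/-- The signal-to-interference-and-noise ratio `ξ(t)`; it is `0` if the interference is infinite. -/
noncomputable def sinr (t : ℕ) (ω : Ω) : ℝ≥0∞ :=
  N.power P 0 t ω /
    (ENNReal.ofReal P.N₀ + ∑' i : ℕ, (N.access P (i + 1) t ω : ℝ≥0∞) * N.power P (i + 1) t ω)

open Classical in
/-- The success indicator `S(t)`, equal to `1` iff `C_0(t) ξ(t) > γ`. -/
noncomputable def success (t : ℕ) (ω : Ω) : ℕ :=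
  if ENNReal.ofReal P.γ < (N.access P 0 t ω : ℝ≥0∞) * N.sinr P t ω then 1 else 0

/-- The event that there is a run of at least `v` ones in `S(kT), …, S((k+1)T-1)`. -/
def blockControllable (v k : ℕ) : Set Ω :=
  {ω | ∃ s, k * P.T ≤ s ∧ s + v ≤ (k + 1) * P.T ∧ ∀ τ < v, N.success P (s + τ) ω = 1}

/-- The information in the locations of all controllers and in the activities of the interfering
controllers in block `k`. -/
noncomputable def environment (k : ℕ) : MeasurableSpace Ω :=
  (⨆ i, MeasurableSpace.comap (N.pos i) inferInstance) ⊔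
    ⨆ i, MeasurableSpace.comap (N.active (i + 1) k) inferInstance

variable [MeasurableSpace Ω] (μ : Measure Ω)

/-- The probability measure given that the typical controller transmits in block `k`. -/
noncomputable def givenTransmits (k : ℕ) : Measure Ω :=
  ProbabilityTheory.cond μ {ω | N.active 0 k ω = true}

/-- `P_blk`: given that the typical controller transmits in block `k`, the conditional probability
of success in slot `t` for the given network realization. -/
noncomputable def condSuccess (k t : ℕ) : Ω → ℝ :=
  (N.givenTransmits μ k)⟦{ω | N.success P t ω = 1} | N.environment k⟧

/-- `F̄(v)`: given that the typical controller transmits in block `k`, the conditional probability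
of block controllability for the given network realization. -/
noncomputable def condControllable (v k : ℕ) : Ω → ℝ :=
  (N.givenTransmits μ k)⟦N.blockControllable P v k | N.environment k⟧

end Network

/-! ### The closed form -/

namespace Params

variable (P : Params)

/-- The integrand `(-γ z^{-α} / (r₀^{-α} + γ z^{-α}))^j z` of the `j`th radial integral. -/
noncomputable def integrand (j : ℕ) (z : ℝ) : ℝ :=
  (-(P.γ * z ^ (-P.α)) / (P.r₀ ^ (-P.α) + P.γ * z ^ (-P.α))) ^ j * z

/-- The integral over `(0, ∞)` of the `j`th integrand, with values in `[-∞, ∞]`: integral of the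
positive part minus integral of the negative part (one of them vanishes). -/
noncomputable def radialIntegral (j : ℕ) : EReal :=
  ((∫⁻ z in Ioi (0 : ℝ), ENNReal.ofReal (P.integrand j z) : ℝ≥0∞) : EReal) -
    ((∫⁻ z in Ioi (0 : ℝ), ENNReal.ofReal (-P.integrand j z) : ℝ≥0∞) : EReal)

/-- `I(l)`, where a sum with a term `-∞` is `-∞`. -/
noncomputable def I (l : ℕ) : EReal :=
  ∑ j ∈ Finset.Icc 1 l, ((l.choose j : ℝ) : EReal) * P.radialIntegral j

/-- `ζ(l) = exp(-γ N₀ l / (η ρ r₀^{-α})) exp(2 π λ q I(l))`, with `exp(-∞) = 0`. -/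
noncomputable def zeta (l : ℕ) : ℝ :=
  Real.exp (-(P.γ * P.N₀ * l) / (P.η * P.ρ * P.r₀ ^ (-P.α))) *
    (EReal.exp (((2 * Real.pi * P.lam * P.q : ℝ) : EReal) * P.I l)).toReal

end Params

end PoissonControl

/-!
Dividing the SINR inequality by the mean received power, success in a slot means that the standard
exponential variable `‖h₀‖²` exceeds a threshold made of the noise and of the weighted exponential
fading of the active interferers. Given the environment (locations and activities of the
interferers), the success probability is therefore the Laplace transform of that threshold, a
product of an explicit noise factor and of one factor `weight ‖x i‖` for each active interferer
`i`; see `Params.measureReal_mem_successSet`. With `negExp x = exp (-x)` on `[0, ∞]` such infinite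
products become sums in `[0, ∞]`, so that no convergence has to be assumed, and infinite
interference gives success probability zero.

The `l`th moment of the success probability is found by averaging over the activities, which
replaces `weight ^ l` by `1 - q * (1 - weight ^ l)`, and then over the locations. The latter is
the Laplace functional of a Poisson process (`IsPoissonPointProcess.lintegral_negExp_tsum`),
obtained from independent Poisson counts by monotone approximation. In polar coordinates the
exponent is the integral of `(1 - weight ^ l) z`, and the binomial expansion of `1 - weight ^ l =
1 - (1 + (weight - 1)) ^ l` identifies it with `-I(l)`. If the first of the expanded integrals
diverges, both sides are infinite, since `1 - weight ^ l ≥ 1 - weight`; otherwise all integrals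
are finite (`Params.I_eq_neg_lintegral`).

The transmission of the typical controller is independent of the environment and of the fading,
and the fading vectors of different slots are independent, so conditioning on the transmission and
the environment amounts to freezing the environment (`Network.IsBlockAloha.condProb_ae_eq`). The
slots of a block are then Bernoulli trials, and the probability of a run of `v` successes is de
Moivre's formula `measureReal_run`, which follows from the recurrence `a (T + v + 1) = a (T + v) -
p ^ v * (1 - p) * a T` for the probability of having no run. Expanding the powers of `1 - p` and
integrating yields the moments `ζ`.
-/

namespace PoissonControl

/-! ### Laplace transforms of extended nonnegative random variables -/

/-- The function `x ↦ exp (-x)` on `[0, ∞]`, with `exp (-∞) = 0`. -/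
noncomputable def negExp (x : ℝ≥0∞) : ℝ≥0∞ := EReal.exp (-(x : EReal))

/-- The function `y ↦ -log y`, with values in `[0, ∞]`; it is inverse to `negExp` on `[0, 1]`. -/
noncomputable def negLog (y : ℝ≥0∞) : ℝ≥0∞ := (-(ENNReal.log y)).toENNReal

@[simp] lemma negExp_zero : negExp 0 = 1 := by simp [negExp]

@[simp] lemma negExp_top : negExp ⊤ = 0 := by simp [negExp]

lemma negExp_add (x y : ℝ≥0∞) : negExp (x + y) = negExp x * negExp y := by
  rw [negExp, EReal.coe_ennreal_add, EReal.neg_add, sub_eq_add_neg, EReal.exp_add]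
  · rfl
  · left; simp
  · right; simp

lemma negExp_antitone : Antitone negExp := fun x y h => by
  apply EReal.exp_monotone
  simpa using h

lemma negExp_le_one (x : ℝ≥0∞) : negExp x ≤ 1 := by
  simpa using negExp_antitone (zero_le (a := x))

lemma negExp_ne_top (x : ℝ≥0∞) : negExp x ≠ ⊤ :=
  ((negExp_le_one x).trans_lt ENNReal.one_lt_top).ne

lemma negExp_ofReal {x : ℝ} (hx : 0 ≤ x) :
    negExp (ENNReal.ofReal x) = ENNReal.ofReal (Real.exp (-x)) := by
  rw [negExp, EReal.coe_ennreal_ofReal, max_eq_left hx, ← EReal.coe_neg, EReal.exp_coe]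

lemma continuous_negExp : Continuous negExp :=
  ENNReal.continuous_exp.comp (continuous_neg.comp continuous_coe_ennreal_ereal)

lemma measurable_negExp : Measurable negExp := continuous_negExp.measurable

lemma negExp_sum {ι : Type*} (s : Finset ι) (f : ι → ℝ≥0∞) :
    negExp (∑ i ∈ s, f i) = ∏ i ∈ s, negExp (f i) := by
  classical
  induction s using Finset.induction_on with
  | empty => simp
  | insert a s ha ih => rw [Finset.sum_insert ha, Finset.prod_insert ha, negExp_add, ih]

lemma negExp_pow (x : ℝ≥0∞) (l : ℕ) : negExp x ^ l = negExp (l * x) := by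
  induction l with
  | zero => simp
  | succ l ih => rw [pow_succ, ih, Nat.cast_succ, add_mul, one_mul, negExp_add]

lemma negExp_negLog {y : ℝ≥0∞} (hy : y ≤ 1) : negExp (negLog y) = y := by
  have h : 0 ≤ -(ENNReal.log y) := by
    have : ENNReal.log y ≤ 0 := by simpa using hy
    simpa using EReal.neg_le_neg_iff.mpr this
  rw [negExp, negLog, EReal.coe_toENNReal h, neg_neg, ENNReal.exp_log]

lemma measurable_negLog : Measurable negLog := by
  unfold negLog
  exact (ENNReal.measurable_log.neg).ereal_toENNReal

lemma tendsto_negExp_sum_range (f : ℕ → ℝ≥0∞) :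
    Filter.Tendsto (fun n => negExp (∑ i ∈ Finset.range n, f i)) Filter.atTop
      (nhds (negExp (∑' i, f i))) :=
  (continuous_negExp.tendsto _).comp ENNReal.summable.hasSum.tendsto_sum_nat

lemma tendsto_lintegral_negExp {Ω : Type*} [MeasurableSpace Ω] (μ : Measure Ω) [IsFiniteMeasure μ]
    {f : ℕ → Ω → ℝ≥0∞} {g : Ω → ℝ≥0∞} (hf : ∀ n, Measurable (f n))
    (h : ∀ ω, Filter.Tendsto (fun n => f n ω) Filter.atTop (nhds (g ω))) :
    Filter.Tendsto (fun n => ∫⁻ ω, negExp (f n ω) ∂μ) Filter.atTop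
      (nhds (∫⁻ ω, negExp (g ω) ∂μ)) := by
  refine tendsto_lintegral_of_dominated_convergence (fun _ => 1)
    (fun n => measurable_negExp.comp (hf n)) (fun n => ae_of_all _ fun ω => negExp_le_one _) ?_
    (ae_of_all _ fun ω => (continuous_negExp.tendsto _).comp (h ω))
  simp

/-- The Laplace transform of a series of independent variables is the product of the Laplace
transforms; writing the factors as `negExp (ψ i)` turns the infinite product into a sum. -/
lemma lintegral_negExp_tsum {Ω : Type*} [MeasurableSpace Ω] {μ : Measure Ω}
    [IsProbabilityMeasure μ] {Z : ℕ → Ω → ℝ≥0∞} (hZ : ∀ i, Measurable (Z i))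
    (hind : iIndepFun Z μ) {ψ : ℕ → ℝ≥0∞}
    (hψ : ∀ i, ∫⁻ ω, negExp (Z i ω) ∂μ = negExp (ψ i)) :
    ∫⁻ ω, negExp (∑' i, Z i ω) ∂μ = negExp (∑' i, ψ i) := by
  refine tendsto_nhds_unique (tendsto_lintegral_negExp μ
    (f := fun n ω => ∑ i ∈ Finset.range n, Z i ω)
    (fun n => Finset.measurable_sum _ fun i _ => hZ i)
    (fun ω => ENNReal.summable.hasSum.tendsto_sum_nat)) ?_
  convert tendsto_negExp_sum_range ψ using 2 with n
  simp_rw [negExp_sum, ← hψ]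
  exact lintegral_prod_eq_prod_lintegral_of_indepFun _ _
    (hind.comp (fun _ => negExp) fun _ => measurable_negExp)
    fun i => measurable_negExp.comp (hZ i)

/-! ### Exponential variables -/

lemma measure_lt_of_map_eq_expMeasure {Ω : Type*} [MeasurableSpace Ω] {μ : Measure Ω}
    {X : Ω → ℝ} (hX : Measurable X) (h : μ.map X = expMeasure 1) (s : ℝ≥0∞) :
    μ {ω | s < ENNReal.ofReal (X ω)} = negExp s := by
  induction s with
  | top => simp
  | coe s =>
    have : IsProbabilityMeasure (expMeasure 1) := isProbabilityMeasure_expMeasure one_pos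
    have hset : {ω | (s : ℝ≥0∞) < ENNReal.ofReal (X ω)} = X ⁻¹' (Iic (s : ℝ))ᶜ := by
      ext ω
      rw [mem_preimage, mem_compl_iff, mem_Iic, not_le, mem_ofPred_eq,
        ← ENNReal.ofReal_coe_nnreal, ENNReal.ofReal_lt_ofReal_iff']
      exact ⟨fun h => h.1, fun h => ⟨h, s.2.trans_lt h⟩⟩
    have hcdf : expMeasure 1 (Iic (s : ℝ)) = ENNReal.ofReal (1 - Real.exp (-s)) := by
      rw [← ENNReal.ofReal_toReal (measure_ne_top (expMeasure 1) _), ← Measure.real,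
        ← cdf_eq_real, cdf_expMeasure_eq one_pos, if_pos s.coe_nonneg, one_mul]
    rw [hset, ← Measure.map_apply hX measurableSet_Iic.compl, h,
      prob_compl_eq_one_sub measurableSet_Iic, hcdf, ← ENNReal.ofReal_coe_nnreal (p := s),
      negExp_ofReal s.coe_nonneg, ← ENNReal.ofReal_one, ← ENNReal.ofReal_sub]
    · simp
    · simp

/-- The Laplace transform of the standard exponential distribution. -/
lemma lintegral_negExp_mul_of_map_eq_expMeasure {Ω : Type*} [MeasurableSpace Ω] {μ : Measure Ω}
    {X : Ω → ℝ} (hX : Measurable X) (h : μ.map X = expMeasure 1) {c : ℝ} (hc : 0 ≤ c) :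
    ∫⁻ ω, negExp (ENNReal.ofReal (c * X ω)) ∂μ = ENNReal.ofReal (1 / (1 + c)) := by
  have hm : Measurable fun x : ℝ => negExp (ENNReal.ofReal (c * x)) :=
    measurable_negExp.comp (measurable_id.const_mul c).ennreal_ofReal
  have hexp : expMeasure 1 = volume.withDensity (exponentialPDF 1) := rfl
  have hpdf : Measurable (exponentialPDF 1) := (measurable_exponentialPDFReal 1).ennreal_ofReal
  rw [← lintegral_map (f := fun x => negExp (ENNReal.ofReal (c * x))) hm hX, h, hexp,
    lintegral_withDensity_eq_lintegral_mul _ hpdf hm]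
  -- the integrand is `1 / (1 + c)` times the density of the exponential law of rate `1 + c`
  have key : (exponentialPDF 1 * fun x => negExp (ENNReal.ofReal (c * x))) =
      fun x => ENNReal.ofReal (1 / (1 + c)) * exponentialPDF (1 + c) x := by
    funext x
    rcases lt_or_ge x 0 with hx | hx
    · simp [exponentialPDF_of_neg hx]
    · rw [Pi.mul_apply, exponentialPDF_of_nonneg hx, exponentialPDF_of_nonneg hx,
        negExp_ofReal (by positivity), ← ENNReal.ofReal_mul (by positivity),
        ← ENNReal.ofReal_mul (by positivity), one_mul, one_mul, ← Real.exp_add, ← mul_assoc,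
        one_div, inv_mul_cancel₀ (by positivity), one_mul]
      congr 2
      ring
  rw [key, lintegral_const_mul (f := exponentialPDF (1 + c)) _
    ((measurable_exponentialPDFReal _).ennreal_ofReal),
    lintegral_exponentialPDF_eq_one (by positivity), mul_one]

end PoissonControl

namespace PoissonControl

/-! ### The Laplace functional of a Poisson point process -/

/-- The Laplace transform of a Poisson variable of mean `r`. -/
lemma lintegral_negExp_mul_of_poisson {Ω : Type*} [MeasurableSpace Ω] {μ : Measure Ω}
    [IsProbabilityMeasure μ] {K : Ω → ℕ∞} (hK : Measurable K) {r : ℝ} (hr : 0 ≤ r)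
    (h : ∀ n : ℕ, μ.real {ω | K ω = (n : ℕ∞)} = Real.exp (-r) * r ^ n / (n.factorial : ℝ))
    (c : ℝ≥0∞) :
    ∫⁻ ω, negExp (c * (K ω : ℝ≥0∞)) ∂μ = negExp (ENNReal.ofReal r * (1 - negExp c)) := by
  have hmeas : ∀ n : ℕ, MeasurableSet {ω | K ω = (n : ℕ∞)} := fun n =>
    hK (measurableSet_singleton _)
  have hval : ∀ n : ℕ, μ {ω | K ω = (n : ℕ∞)} =
      ENNReal.ofReal (Real.exp (-r) * r ^ n / (n.factorial : ℝ)) := fun n => by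
    rw [← h n, Measure.real, ENNReal.ofReal_toReal (measure_ne_top _ _)]
  have hsum : ∀ s : ℝ, HasSum (fun n : ℕ => Real.exp (-r) * s ^ n / (n.factorial : ℝ))
      (Real.exp (-r) * Real.exp s) := fun s => by
    have h := (NormedSpace.expSeries_div_hasSum_exp (𝔸 := ℝ) s).mul_left (Real.exp (-r))
    rw [← Real.exp_eq_exp_ℝ] at h
    simpa only [mul_div_assoc] using h
  have hdisj : Pairwise (Function.onFun Disjoint fun n : ℕ => {ω | K ω = (n : ℕ∞)}) := by
    intro a b hab
    rw [Function.onFun, Set.disjoint_left]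
    intro ω ha hb
    exact hab (by exact_mod_cast (ha : K ω = a).symm.trans (hb : K ω = b))
  -- a Poisson variable is almost surely finite, because its point masses add up to one
  have hfin : ∀ᵐ ω ∂μ, ω ∈ ⋃ n : ℕ, {ω | K ω = (n : ℕ∞)} := by
    refine (mem_ae_iff_prob_eq_one (MeasurableSet.iUnion hmeas)).2 ?_
    rw [measure_iUnion hdisj hmeas]
    simp_rw [hval]
    rw [← ENNReal.ofReal_tsum_of_nonneg (fun n => by positivity) (hsum r).summable,
      (hsum r).tsum_eq, ← Real.exp_add]
    simp
  set t : ℝ := (negExp c).toReal with ht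
  have ht0 : 0 ≤ t := ENNReal.toReal_nonneg
  have ht1 : t ≤ 1 := ENNReal.toReal_le_of_le_ofReal zero_le_one (by simpa using negExp_le_one c)
  have htc : negExp c = ENNReal.ofReal t := (ENNReal.ofReal_toReal (negExp_ne_top c)).symm
  calc ∫⁻ ω, negExp (c * (K ω : ℝ≥0∞)) ∂μ
      = ∫⁻ ω, ∑' n : ℕ, {ω | K ω = (n : ℕ∞)}.indicator (fun _ => negExp c ^ n) ω ∂μ := by
        refine lintegral_congr_ae (hfin.mono fun ω hω => ?_)
        obtain ⟨n, hn⟩ := mem_iUnion.1 hω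
        have hn' : K ω = n := hn
        dsimp only
        rw [tsum_eq_single n, indicator_of_mem hn, hn', negExp_pow, mul_comm]
        · simp
        · intro b hb
          refine indicator_of_notMem (fun hb' => hb ?_) _
          exact_mod_cast (hb' : K ω = b).symm.trans hn'
    _ = ∑' n : ℕ, negExp c ^ n * μ {ω | K ω = (n : ℕ∞)} := by
        rw [lintegral_tsum fun n => (measurable_const.indicator (hmeas n)).aemeasurable]
        exact tsum_congr fun n => lintegral_indicator_const (hmeas n) _
    _ = ∑' n : ℕ, ENNReal.ofReal (Real.exp (-r) * (r * t) ^ n / (n.factorial : ℝ)) := by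
        refine tsum_congr fun n => ?_
        rw [hval, htc, ← ENNReal.ofReal_pow ht0, ← ENNReal.ofReal_mul (by positivity)]
        congr 1
        rw [mul_pow]
        ring
    _ = ENNReal.ofReal (Real.exp (-(r * (1 - t)))) := by
        rw [← ENNReal.ofReal_tsum_of_nonneg (fun n => by positivity) (hsum _).summable,
          (hsum _).tsum_eq, ← Real.exp_add]
        congr 2
        ring
    _ = negExp (ENNReal.ofReal r * (1 - negExp c)) := by
        rw [htc, ← ENNReal.ofReal_one, ← ENNReal.ofReal_sub _ ht0, ← ENNReal.ofReal_mul hr,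
          negExp_ofReal (mul_nonneg hr (sub_nonneg.2 ht1))]

variable {Ω : Type*}

lemma coe_count (x : ℕ → Ω → Plane) (B : Set Plane) (ω : Ω) :
    (count x B ω : ℝ≥0∞) = ∑' i, B.indicator (fun _ => (1 : ℝ≥0∞)) (x i ω) := by
  rw [count, ← ENNReal.tsum_set_one, tsum_subtype {i | x i ω ∈ B} fun _ => (1 : ℝ≥0∞)]
  rfl

variable [MeasurableSpace Ω]

lemma measurable_count {x : ℕ → Ω → Plane} (hx : ∀ i, Measurable (x i)) {B : Set Plane}
    (hB : MeasurableSet B) : Measurable (count x B) := by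
  refine measurable_encard.comp (measurable_set_iff.2 fun i => ?_)
  exact (measurable_mem.2 hB).comp (hx i)

namespace IsPoissonPointProcess

variable {μ : Measure Ω} {lam : ℝ} {x : ℕ → Ω → Plane}

/-- The Laplace functional on simple functions of bounded support: the sum over the process is a
linear combination of independent Poisson variables. -/
lemma lintegral_negExp_tsum_simpleFunc [IsProbabilityMeasure μ]
    (hx : IsPoissonPointProcess μ lam x) (hlam : 0 ≤ lam) (g : SimpleFunc Plane ℝ≥0∞)
    {D : Set Plane} (hD : MeasurableSet D) (hDb : Bornology.IsBounded D) :
    ∫⁻ ω, negExp (∑' i, D.indicator g (x i ω)) ∂μ =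
      negExp (ENNReal.ofReal lam * ∫⁻ y in D, (1 - negExp (g y))) := by
  set B : g.range → Set Plane := fun c => g ⁻¹' {c.1} ∩ D with hBdef
  have hB : ∀ c, MeasurableSet (B c) := fun c => (g.measurableSet_fiber _).inter hD
  have hBb : ∀ c, Bornology.IsBounded (B c) := fun c => hDb.subset inter_subset_right
  have hdisj : Pairwise fun c c' => Disjoint (B c) (B c') := by
    intro c c' hcc'
    rw [Set.disjoint_left]
    rintro y ⟨h1, -⟩ ⟨h2, -⟩
    exact hcc' (Subtype.ext ((show g y = c from h1).symm.trans h2))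
  have hsum : ∀ ω, ∑' i, D.indicator g (x i ω) = ∑ c, c.1 * (count x (B c) ω : ℝ≥0∞) := by
    intro ω
    simp_rw [coe_count, ← ENNReal.tsum_mul_left]
    rw [← Summable.tsum_finsetSum fun c _ => ENNReal.summable]
    refine tsum_congr fun i => ?_
    by_cases hi : x i ω ∈ D
    · rw [indicator_of_mem hi, Finset.sum_eq_single ⟨g (x i ω), g.mem_range_self _⟩]
      · rw [indicator_of_mem (show x i ω ∈ B ⟨g (x i ω), _⟩ from ⟨rfl, hi⟩), mul_one]
      · intro c _ hc
        rw [indicator_of_notMem, mul_zero]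
        rintro ⟨h, -⟩
        exact hc (Subtype.ext (show g (x i ω) = c from h).symm)
      · simp
    · rw [indicator_of_notMem hi]
      refine (Finset.sum_eq_zero fun c _ => ?_).symm
      rw [indicator_of_notMem (fun h => hi h.2), mul_zero]
  have hind : iIndepFun (fun c => count x (B c)) μ := by
    have e := Fintype.equivFin g.range
    have := (hx.indep _ (fun j => B (e.symm j)) (fun j => hB _) (fun j => hBb _)
      (fun j j' h => hdisj (e.symm.injective.ne h))).precomp e.injective
    simpa [Function.comp_def] using this
  have hone : ∀ c, ∫⁻ ω, negExp (c.1 * (count x (B c) ω : ℝ≥0∞)) ∂μ =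
      negExp (ENNReal.ofReal lam * ((1 - negExp c.1) * volume (B c))) := by
    intro c
    rw [lintegral_negExp_mul_of_poisson (measurable_count hx.measurable (hB c))
      (by positivity) (hx.poisson _ (hB c) (hBb c)), ENNReal.ofReal_mul hlam, Measure.real,
      ENNReal.ofReal_toReal (hBb c).measure_lt_top.ne, mul_assoc, mul_comm (volume _)]
  have hint : ∫⁻ y in D, (1 - negExp (g y)) = ∑ c, (1 - negExp c.1) * volume (B c) := by
    have h1 := (g.map fun c => 1 - negExp c).lintegral_eq_lintegral (volume.restrict D)
    rw [SimpleFunc.map_lintegral] at h1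
    rw [show (fun y => 1 - negExp (g y)) = (g.map fun c => 1 - negExp c) from rfl, h1,
      ← Finset.sum_coe_sort]
    refine Finset.sum_congr rfl fun c _ => ?_
    rw [Measure.restrict_apply (g.measurableSet_fiber _)]
  simp_rw [hsum, negExp_sum]
  rw [lintegral_prod_eq_prod_lintegral_of_indepFun Finset.univ
    (fun c ω => negExp (c.1 * (count x (B c) ω : ℝ≥0∞)))
    (hind.comp (fun c n => negExp (c.1 * (n : ℝ≥0∞))) fun _ => measurable_from_top)
    fun c => (measurable_from_top (f := fun n : ℕ∞ => negExp (c.1 * (n : ℝ≥0∞)))).comp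
      (measurable_count hx.measurable (hB c))]
  simp_rw [hone]
  rw [← negExp_sum, ← Finset.mul_sum, hint]

/-- The Laplace functional of the Poisson point process, for an arbitrary nonnegative function. -/
theorem lintegral_negExp_tsum [IsProbabilityMeasure μ]
    (hx : IsPoissonPointProcess μ lam x) (hlam : 0 ≤ lam) {f : Plane → ℝ≥0∞} (hf : Measurable f) :
    ∫⁻ ω, negExp (∑' i, f (x i ω)) ∂μ =
      negExp (ENNReal.ofReal lam * ∫⁻ y, (1 - negExp (f y))) := by
  -- approximation by simple functions cut off outside balls
  set D : ℕ → Set Plane := fun n => Metric.ball 0 n with hDdef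
  have hD : ∀ n, MeasurableSet (D n) := fun n => measurableSet_ball
  set F : ℕ → Plane → ℝ≥0∞ := fun n => (D n).indicator (SimpleFunc.eapprox f n) with hFdef
  have hF : ∀ n, Measurable (F n) := fun n => (SimpleFunc.measurable _).indicator (hD n)
  have hmono : ∀ y, Monotone fun n => F n y := by
    intro y a b hab
    have hsub : D a ⊆ D b := Metric.ball_subset_ball (by exact_mod_cast hab)
    exact (indicator_le_indicator_of_subset hsub (fun _ => zero_le) y).trans
      (indicator_le_indicator (SimpleFunc.monotone_eapprox f hab y))
  have hlim : ∀ y, Filter.Tendsto (fun n => F n y) Filter.atTop (nhds (f y)) := by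
    intro y
    refine (SimpleFunc.tendsto_eapprox hf y).congr' ?_
    obtain ⟨N, hN⟩ := exists_nat_gt ‖y‖
    filter_upwards [Filter.eventually_ge_atTop N] with n hn
    have : y ∈ D n := by
      simp only [hDdef, Metric.mem_ball, dist_zero_right]
      exact hN.trans_le (by exact_mod_cast hn)
    exact (indicator_of_mem this _).symm
  have hleft : Filter.Tendsto (fun n => ∫⁻ ω, negExp (∑' i, F n (x i ω)) ∂μ) Filter.atTop
      (nhds (∫⁻ ω, negExp (∑' i, f (x i ω)) ∂μ)) := by
    refine tendsto_lintegral_negExp μ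
      (fun n => Measurable.tsum fun i => (hF n).comp (hx.measurable i)) fun ω => ?_
    simp_rw [← lintegral_count]
    exact lintegral_tendsto_of_tendsto_of_monotone
      (fun n => (measurable_of_countable _).aemeasurable)
      (ae_of_all _ fun i => hmono _) (ae_of_all _ fun i => hlim _)
  have hright : Filter.Tendsto (fun n => negExp (ENNReal.ofReal lam * ∫⁻ y, (1 - negExp (F n y))))
      Filter.atTop (nhds (negExp (ENNReal.ofReal lam * ∫⁻ y, (1 - negExp (f y))))) := by
    refine (continuous_negExp.tendsto _).comp
      (ENNReal.Tendsto.const_mul ?_ (Or.inr ENNReal.ofReal_ne_top))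
    refine lintegral_tendsto_of_tendsto_of_monotone
      (fun n => (measurable_const.sub (measurable_negExp.comp (hF n))).aemeasurable)
      (ae_of_all _ fun y a b hab => tsub_le_tsub_left (negExp_antitone (hmono y hab)) _)
      (ae_of_all _ fun y => ?_)
    exact ENNReal.Tendsto.sub tendsto_const_nhds
      ((continuous_negExp.tendsto _).comp (hlim y)) (Or.inl ENNReal.one_ne_top)
  refine tendsto_nhds_unique hleft (hright.congr fun n => ?_)
  rw [lintegral_negExp_tsum_simpleFunc hx hlam _ (hD n) Metric.isBounded_ball,
    ← lintegral_indicator (hD n)]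
  congr 3 with y
  by_cases hy : y ∈ D n <;> simp [hFdef, hy]

end IsPoissonPointProcess

end PoissonControl

namespace PoissonControl

/-! ### Runs of successes in Bernoulli trials -/

/-- The binomial coefficient `(T - l v).choose l`, set to zero where `l v > T`. -/
def runChoose (v T l : ℕ) : ℕ := if l * v ≤ T then (T - l * v).choose l else 0

lemma runChoose_zero (v T : ℕ) : runChoose v T 0 = 1 := by simp [runChoose]

lemma runChoose_eq_zero {v T l : ℕ} (h : T < l * v + l) : runChoose v T l = 0 := by
  rw [runChoose]
  split_ifs
  · exact Nat.choose_eq_zero_of_lt (by omega)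
  · rfl

lemma runChoose_add (v T l : ℕ) : runChoose v (T + v) (l + 1) =
    if l * v ≤ T then (T - l * v).choose (l + 1) else 0 := by
  have h : (l + 1) * v = l * v + v := by ring
  simp only [runChoose, h, Nat.add_sub_add_right, add_le_add_iff_right]

lemma runChoose_succ (v T l : ℕ) : runChoose v (T + v + 1) (l + 1) =
    runChoose v (T + v) (l + 1) + runChoose v T l := by
  rw [add_right_comm, runChoose_add, runChoose_add, runChoose]
  rcases lt_trichotomy (l * v) (T + 1) with h | h | h
  · have h' : l * v ≤ T := by omega
    rw [if_pos h.le, if_pos h', if_pos h', show T + 1 - l * v = (T - l * v) + 1 by omega,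
      Nat.choose_succ_succ, add_comm]
  · rw [if_pos h.le, if_neg (by omega), if_neg (by omega), h]
    simp
  · rw [if_neg (by omega), if_neg (by omega), if_neg (by omega)]

/-- The solution `∑ l, (-c) ^ l * (T - l v).choose l` of the recurrence
`b (T + v + 1) = b (T + v) - c * b T` with initial values `1`. -/
def runSum (v : ℕ) (c : ℝ) (T : ℕ) : ℝ :=
  ∑ l ∈ Finset.range (T + 1), (-c) ^ l * (runChoose v T l : ℝ)

lemma runSum_eq {v T N : ℕ} (c : ℝ) (hN : ∀ l, N ≤ l → runChoose v T l = 0) :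
    runSum v c T = ∑ l ∈ Finset.range N, (-c) ^ l * (runChoose v T l : ℝ) := by
  have key : ∀ M, (∀ l, M ≤ l → runChoose v T l = 0) →
      ∑ l ∈ Finset.range M, (-c) ^ l * (runChoose v T l : ℝ) =
        ∑ l ∈ Finset.range (max N (T + 1) + M), (-c) ^ l * (runChoose v T l : ℝ) := by
    intro M hM
    refine Finset.sum_subset (Finset.range_mono (by omega)) fun l _ hl => ?_
    rw [hM l (by simpa using hl)]
    simp
  have h1 := Finset.sum_subset (f := fun l => (-c) ^ l * (runChoose v T l : ℝ))
    (Finset.range_mono (show T + 1 ≤ max N (T + 1) by omega)) fun l _ hl => by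
      rw [runChoose_eq_zero]
      · simp
      · have : T + 1 ≤ l := by simpa using hl
        omega
  have h2 := Finset.sum_subset (f := fun l => (-c) ^ l * (runChoose v T l : ℝ))
    (Finset.range_mono (show N ≤ max N (T + 1) by omega)) fun l _ hl => by
      rw [hN l (by simpa using hl)]
      simp
  rw [runSum, h1, h2]

lemma runSum_of_le {v T : ℕ} (c : ℝ) (h : T ≤ v) : runSum v c T = 1 := by
  rw [runSum_eq (N := 1) c]
  · simp [runChoose_zero]
  · intro l hl
    refine runChoose_eq_zero ?_
    have : v ≤ l * v := Nat.le_mul_of_pos_left v hl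
    omega

lemma runSum_succ (v : ℕ) (c : ℝ) (T : ℕ) :
    runSum v c (T + v + 1) = runSum v c (T + v) - c * runSum v c T := by
  have hz : ∀ S l, S < l → runChoose v S l = 0 := fun S l h => runChoose_eq_zero (by omega)
  rw [runSum_eq (N := (T + v + 1) + 1) c fun l hl => hz _ _ (by omega),
    runSum_eq (T := T + v) (N := (T + v + 1) + 1) c fun l hl => hz _ _ (by omega),
    runSum_eq (T := T) (N := T + v + 1) c fun l hl => hz _ _ (by omega),
    Finset.sum_range_succ', Finset.sum_range_succ' _ (T + v + 1), Finset.mul_sum,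
    runChoose_zero, runChoose_zero, add_sub_right_comm, ← Finset.sum_sub_distrib]
  congr 1
  refine Finset.sum_congr rfl fun l _ => ?_
  rw [runChoose_succ]
  push_cast
  ring

/-- A sequence with the recurrence of the probability that `T` Bernoulli trials contain no run of
length `v`. -/
lemma eq_runSum_of_recurrence {v : ℕ} {p : ℝ} {a : ℕ → ℝ} (h0 : ∀ T < v, a T = 1)
    (hv : a v = 1 - p ^ v)
    (hrec : ∀ T, a (T + v + 1) = a (T + v) - p ^ v * (1 - p) * a T) (T : ℕ) :
    a (T + v) = runSum v (p ^ v * (1 - p)) (T + v) -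
      p ^ v * runSum v (p ^ v * (1 - p)) T := by
  induction T using Nat.strong_induction_on with
  | _ T ih =>
    rcases T with _ | T
    · rw [zero_add, hv, runSum_of_le _ le_rfl, runSum_of_le _ (Nat.zero_le v), mul_one]
    · rw [show T + 1 + v = T + v + 1 by ring, hrec, ih T (by omega), runSum_succ]
      rcases lt_or_ge T v with h | h
      · rw [h0 T h, runSum_of_le _ h.le, runSum_of_le _ (Nat.succ_le_of_lt h)]
        ring
      · obtain ⟨S, rfl⟩ := Nat.exists_eq_add_of_le' h
        rw [ih S (by omega), runSum_succ]
        ring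

/-- The closed form of `1 - a`, for the solution `a` of the recurrence of the probability of
having no run. -/
lemma one_sub_eq_of_recurrence {v : ℕ} {p : ℝ} {a : ℕ → ℝ} (h0 : ∀ T < v, a T = 1)
    (hv : a v = 1 - p ^ v)
    (hrec : ∀ T, a (T + v + 1) = a (T + v) - p ^ v * (1 - p) * a T) (T : ℕ) :
    1 - a T = ∑ l ∈ Finset.Icc 1 ((T + 1) / (v + 1)),
      (-1 : ℝ) ^ (l + 1) * ((T - l * v).choose (l - 1) : ℝ) *
        (p ^ (l * v + 1) * (1 - p) ^ (l - 1) +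
          ((T : ℝ) - l * v + 1) / l * (p ^ (l * v) * (1 - p) ^ l)) := by
  rcases lt_or_ge T v with h | h
  · rw [h0 T h, Nat.div_eq_of_lt (by omega)]
    simp
  obtain ⟨S, rfl⟩ := Nat.exists_eq_add_of_le' h
  set L := (S + v + 1) / (v + 1) with hL
  have hlt : ∀ l, l < L ↔ l * v + l ≤ S := by
    intro l
    rw [← Nat.succ_le_iff, hL, Nat.le_div_iff_mul_le (Nat.succ_pos v), Nat.succ_eq_add_one,
      show (l + 1) * (v + 1) = l * v + l + v + 1 by ring]
    omega
  clear_value L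
  have hS : ∀ l, L ≤ l → runChoose v S l = 0 := fun l hl =>
    runChoose_eq_zero (not_le.1 ((hlt l).not.1 (not_lt.2 hl)))
  have hSv : ∀ l, L + 1 ≤ l → runChoose v (S + v) l = 0 := by
    intro l hl
    obtain ⟨k, rfl⟩ := Nat.exists_eq_add_of_le' (show 1 ≤ l by omega)
    refine runChoose_eq_zero ?_
    have h1 := not_le.1 ((hlt k).not.1 (by omega))
    have h2 : (k + 1) * v = k * v + v := by ring
    omega
  have hI : ∀ f : ℕ → ℝ, ∑ l ∈ Finset.Icc 1 L, f l = ∑ l ∈ Finset.range L, f (l + 1) := by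
    intro f
    rw [Finset.range_eq_Ico, Finset.sum_Ico_add' f 0 L 1]
    exact Finset.sum_congr (by ext; simp [Order.lt_add_one_iff]) fun _ _ => rfl
  rw [eq_runSum_of_recurrence h0 hv hrec, runSum_eq _ hSv, runSum_eq _ hS, Finset.sum_range_succ',
    runChoose_zero, hI, Finset.mul_sum, pow_zero, Nat.cast_one, mul_one, add_sub_right_comm,
    ← Finset.sum_sub_distrib, sub_add_cancel_right, ← Finset.sum_neg_distrib]
  refine Finset.sum_congr rfl fun l hl => ?_
  obtain ⟨d, hd⟩ := Nat.exists_eq_add_of_le ((hlt l).1 (Finset.mem_range.1 hl))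
  have hle : l * v ≤ S := by
    generalize l * v = m at *
    omega
  have hsub : S - l * v = l + d := by
    generalize l * v = m at *
    omega
  have hsub' : S + v - (l + 1) * v = l + d := by
    rw [add_mul, one_mul, Nat.add_sub_add_right, hsub]
  have hchoose : ((l + d).choose (l + 1) : ℝ) * (l + 1) = (l + d).choose l * d := by
    have := Nat.choose_succ_right_eq (l + d) l
    rw [Nat.add_sub_cancel_left] at this
    exact_mod_cast this
  have hS' : (S : ℝ) = l * v + l + d := by exact_mod_cast hd
  rw [runChoose_add, runChoose, if_pos hle, if_pos hle, hsub, hsub', Nat.add_sub_cancel]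
  have hl0 : ((l : ℝ) + 1) ≠ 0 := by positivity
  rw [eq_div_iff hl0 |>.2 hchoose]
  push_cast
  rw [hS', show (l : ℝ) * v + l + d + v - (l + 1) * v + 1 = l + d + 1 by ring,
    show (l + 1) * v = l * v + v by ring, neg_pow (p ^ v * (1 - p)) (l + 1),
    neg_pow (p ^ v * (1 - p)) l, mul_pow, mul_pow, ← pow_mul, ← pow_mul, mul_comm v (l + 1),
    mul_comm v l]
  field_simp
  ring

variable {Ω : Type*}

/-- The event that the trials `0, …, T - 1`, with success events `E 0, …, E (T - 1)`, contain no
run of `v` consecutive successes. -/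
def noRun (E : ℕ → Set Ω) (v T : ℕ) : Set Ω := {ω | ∀ s, s + v ≤ T → ∃ τ < v, ω ∉ E (s + τ)}

lemma noRun_eq (E : ℕ → Set Ω) (v T : ℕ) :
    noRun E v T = ⋂ s, ⋂ (_ : s + v ≤ T), ⋃ τ, ⋃ (_ : τ < v), (E (s + τ))ᶜ := by
  ext ω
  simp [noRun]

lemma measurableSet_noRun {m : ℕ → MeasurableSpace Ω} {E : ℕ → Set Ω}
    (hE : ∀ t, MeasurableSet[m t] (E t)) (v T : ℕ) :
    MeasurableSet[⨆ t ∈ Iio T, m t] (noRun E v T) := by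
  rw [noRun_eq]
  refine MeasurableSet.iInter fun s => MeasurableSet.iInter fun hs =>
    MeasurableSet.iUnion fun τ => MeasurableSet.iUnion fun hτ => MeasurableSet.compl ?_
  exact (le_iSup₂_of_le (f := fun t (_ : t ∈ Iio T) => m t) (s + τ)
    (mem_Iio.2 (by omega)) le_rfl) _ (hE _)

/-- The first run of `v` successes ends at trial `T + v` iff there is no run in the trials before
`T`, trial `T` fails, and the next `v` trials succeed. -/
lemma noRun_diff (E : ℕ → Set Ω) {v : ℕ} (hv : 1 ≤ v) (T : ℕ) :
    noRun E v (T + v) \ noRun E v (T + v + 1) =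
      noRun E v T ∩ ⋂ t ∈ Finset.Icc T (T + v), if t = T then (E t)ᶜ else E t := by
  ext ω
  simp only [noRun, mem_sdiff, mem_ofPred_eq, mem_inter_iff, mem_iInter, Finset.mem_Icc]
  push Not
  constructor
  · rintro ⟨h1, s, hs, h2⟩
    have hsT : s = T + 1 := by
      by_contra hne
      obtain ⟨τ, hτ, h⟩ := h1 s (by omega)
      exact h (h2 τ hτ)
    subst hsT
    refine ⟨fun s hs => h1 s (by omega), fun t ht => ?_⟩
    split_ifs with htT
    · subst htT
      obtain ⟨τ, hτ, h⟩ := h1 t le_rfl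
      rcases τ with _ | τ
      · simpa using h
      · exact absurd (h2 τ (by omega)) (by rwa [show t + 1 + τ = t + (τ + 1) by ring])
    · obtain ⟨τ, rfl⟩ := Nat.exists_eq_add_of_le (show T + 1 ≤ t by omega)
      exact h2 τ (by omega)
  · rintro ⟨h1, h2⟩
    refine ⟨fun s hs => ?_, T + 1, by omega, fun τ hτ => ?_⟩
    · rcases Nat.lt_or_ge T (s + v) with h | h
      · refine ⟨T - s, by omega, ?_⟩
        have := h2 T (by omega)
        rw [if_pos rfl] at this
        rwa [show s + (T - s) = T by omega]
      · exact h1 s h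
    · have := h2 (T + 1 + τ) (by omega)
      rwa [if_neg (by omega)] at this

variable [mΩ : MeasurableSpace Ω] {μ : Measure Ω}

/-- The recurrence for the probability that the trials contain no run, obtained by decomposing
according to whether the first run ends at the last trial. -/
lemma measureReal_noRun_succ {m : ℕ → MeasurableSpace Ω} (hm : ∀ t, m t ≤ mΩ)
    (hind : iIndep m μ) {E : ℕ → Set Ω} (hE : ∀ t, MeasurableSet[m t] (E t)) {p : ℝ}
    (hp : ∀ t, μ.real (E t) = p) {v : ℕ} (hv : 1 ≤ v) (T : ℕ) :
    μ.real (noRun E v (T + v + 1)) =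
      μ.real (noRun E v (T + v)) - p ^ v * (1 - p) * μ.real (noRun E v T) := by
  have := hind.isProbabilityMeasure
  have hmeas : ∀ S, MeasurableSet (noRun E v S) := fun S =>
    (iSup₂_le fun t _ => hm t) _ (measurableSet_noRun hE v S)
  have hsub : noRun E v (T + v + 1) ⊆ noRun E v (T + v) := fun ω hω s hs => hω s (by omega)
  set F : ℕ → Set Ω := fun t => if t = T then (E t)ᶜ else E t with hF
  have hFm : ∀ t, MeasurableSet[m t] (F t) := by
    intro t
    by_cases h : t = T
    · subst h
      simpa [hF] using (hE t).compl
    · simpa [hF, h] using hE t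
  have hdisj : Disjoint (Iio T) (Ici T) := by
    rw [Set.disjoint_left]
    intro t h1 h2
    exact absurd (mem_Iio.1 h1) (not_lt.2 (mem_Ici.1 h2))
  have h1 := (Indep_iff _ _ _).1 (indep_iSup_of_disjoint hm hind hdisj) _
    (⋂ t ∈ Finset.Icc T (T + v), F t) (measurableSet_noRun hE v T)
    (Finset.measurableSet_biInter _ fun t ht =>
      (le_iSup₂_of_le (f := fun t (_ : t ∈ Ici T) => m t) t
        (Finset.mem_Icc.1 ht).1 le_rfl) _ (hFm t))
  rw [hind.meas_biInter fun t _ => hFm t, ← noRun_diff E hv T] at h1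
  have h2 := measureReal_sdiff_add_inter (μ := μ) (s := noRun E v (T + v)) (hmeas (T + v + 1))
  rw [inter_eq_self_of_subset_right hsub] at h2
  have hprod : ∏ t ∈ Finset.Icc T (T + v), μ.real (F t) = p ^ v * (1 - p) := by
    rw [← Finset.Ico_succ_right_eq_Icc, Finset.prod_eq_prod_Ico_succ_bot (by simp)]
    have : ∀ t ∈ Finset.Ico (T + 1) (Order.succ (T + v)), μ.real (F t) = p := by
      intro t ht
      rw [Finset.mem_Ico] at ht
      rw [hF]
      dsimp only
      rw [if_neg (by omega), hp]
    rw [Finset.prod_congr rfl this, Finset.prod_const, Nat.card_Ico, hF]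
    dsimp only
    rw [if_pos rfl, measureReal_compl (hm _ _ (hE T)), hp, probReal_univ, mul_comm]
    congr 2
    simp
  have h3 : μ.real (noRun E v (T + v) \ noRun E v (T + v + 1)) =
      μ.real (noRun E v T) * (p ^ v * (1 - p)) := by
    rw [Measure.real, h1, ENNReal.toReal_mul, ENNReal.toReal_prod, ← hprod]
    rfl
  linarith

/-- The probability of a run of at least `v` successes in `T` independent trials of success
probability `p`. -/
theorem measureReal_run {m : ℕ → MeasurableSpace Ω} (hm : ∀ t, m t ≤ mΩ)
    (hind : iIndep m μ) {E : ℕ → Set Ω} (hE : ∀ t, MeasurableSet[m t] (E t)) {p : ℝ}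
    (hp : ∀ t, μ.real (E t) = p) {v : ℕ} (hv : 1 ≤ v) (T : ℕ) :
    μ.real {ω | ∃ s, s + v ≤ T ∧ ∀ τ < v, ω ∈ E (s + τ)} =
      ∑ l ∈ Finset.Icc 1 ((T + 1) / (v + 1)),
        (-1 : ℝ) ^ (l + 1) * ((T - l * v).choose (l - 1) : ℝ) *
          (p ^ (l * v + 1) * (1 - p) ^ (l - 1) +
            ((T : ℝ) - l * v + 1) / l * (p ^ (l * v) * (1 - p) ^ l)) := by
  have := hind.isProbabilityMeasure
  have hmeas : ∀ S, MeasurableSet (noRun E v S) := fun S =>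
    (iSup₂_le fun t _ => hm t) _ (measurableSet_noRun hE v S)
  have hcompl : {ω | ∃ s, s + v ≤ T ∧ ∀ τ < v, ω ∈ E (s + τ)} = (noRun E v T)ᶜ := by
    ext ω
    simp only [noRun, mem_compl_iff, mem_ofPred_eq]
    push Not
    rfl
  rw [hcompl, measureReal_compl (hmeas T), probReal_univ]
  refine one_sub_eq_of_recurrence (a := fun S => μ.real (noRun E v S)) (fun S hS => ?_) ?_
    (fun S => measureReal_noRun_succ hm hind hE hp hv S) T
  · have : noRun E v S = univ := by
      ext ω
      simp only [noRun, mem_ofPred_eq, mem_univ, iff_true]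
      intro s hs
      omega
    simp [this]
  · have : noRun E v v = (⋂ t ∈ Finset.range v, E t)ᶜ := by
      ext ω
      simp only [noRun, mem_ofPred_eq, mem_compl_iff, mem_iInter, Finset.mem_range]
      push Not
      constructor
      · intro h
        simpa using h 0 (by omega)
      · intro h s hs
        obtain rfl : s = 0 := by omega
        simpa using h
    have h2 : μ.real (⋂ t ∈ Finset.range v, E t) = p ^ v := by
      rw [Measure.real, hind.meas_biInter fun t _ => hE t, ENNReal.toReal_prod]
      change ∏ t ∈ Finset.range v, μ.real (E t) = p ^ v
      simp [hp]
    rw [this, measureReal_compl, h2, probReal_univ]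
    exact Finset.measurableSet_biInter _ fun t _ => hm t _ (hE t)

end PoissonControl

namespace PoissonControl

/-! ### Polar coordinates -/

/-- Integration in polar coordinates of a nonnegative radial function on the plane. -/
lemma lintegral_fun_norm_plane {f : ℝ → ℝ≥0∞} (hf : Measurable f) :
    ∫⁻ y : Plane, f ‖y‖ =
      ENNReal.ofReal (2 * Real.pi) * ∫⁻ z in Ioi (0 : ℝ), ENNReal.ofReal z * f z := by
  have hdim : Module.finrank ℝ Plane = 2 := by simp
  have : Nontrivial Plane := Module.nontrivial_of_finrank_pos (R := ℝ) (by rw [hdim]; norm_num)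
  calc ∫⁻ y : Plane, f ‖y‖
      = ∫⁻ y : ({(0 : Plane)}ᶜ : Set Plane), f ‖y.1‖ ∂(volume.comap Subtype.val) := by
        rw [lintegral_subtype_comap (measurableSet_singleton _).compl fun y : Plane => f ‖y‖,
          restrict_compl_singleton]
    _ = ∫⁻ x, f x.2 ∂(volume : Measure Plane).toSphere.prod
          (.volumeIoiPow (Module.finrank ℝ Plane - 1)) := by
        simpa using ((volume : Measure Plane).measurePreserving_homeomorphUnitSphereProd
          ).lintegral_comp_emb (Homeomorph.measurableEmbedding _) fun x => f x.2
    _ = (volume : Measure Plane).toSphere univ *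
          ∫⁻ z : Ioi (0 : ℝ), f z ∂(.volumeIoiPow (Module.finrank ℝ Plane - 1)) := by
        have hm : Measurable fun x : ↥(Metric.sphere (0 : Plane) 1) × ↥(Ioi (0 : ℝ)) =>
          f x.2 := by fun_prop
        rw [lintegral_prod _ hm.aemeasurable]
        dsimp only
        rw [lintegral_const, mul_comm]
    _ = _ := by
        rw [Measure.toSphere_apply_univ, hdim, EuclideanSpace.volume_ball_fin_two]
        rw [Measure.volumeIoiPow, lintegral_withDensity_eq_lintegral_mul _ (by fun_prop)
          (by fun_prop)]
        congr 1
        · rw [ENNReal.ofReal_mul zero_le_two]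
          simp
        · rw [← lintegral_subtype_comap measurableSet_Ioi]
          simp

namespace Params

variable (P : Params)

/-! ### The radial integrals -/

/-- The Laplace transform of the interference from an active controller at distance `z`, at the
argument that corresponds to the success event. For `z = 0` the power `0 ^ (-α)` is `0` and the
weight is `1`; this has no effect, because the origin is a null set. -/
noncomputable def weight (z : ℝ) : ℝ :=
  P.r₀ ^ (-P.α) / (P.r₀ ^ (-P.α) + P.γ * z ^ (-P.α))

lemma measurable_weight : Measurable P.weight := by
  unfold weight
  fun_prop

variable {P}

lemma weight_pos (hγ : 0 < P.γ) (hr₀ : 0 < P.r₀) {z : ℝ} (hz : 0 ≤ z) : 0 < P.weight z := by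
  unfold weight
  positivity

lemma weight_le_one (hγ : 0 < P.γ) (hr₀ : 0 < P.r₀) {z : ℝ} (hz : 0 ≤ z) : P.weight z ≤ 1 := by
  unfold weight
  refine div_le_one_of_le₀ (le_add_of_nonneg_right ?_) ?_ <;> positivity

lemma integrand_eq (hγ : 0 < P.γ) (hr₀ : 0 < P.r₀) (j : ℕ) {z : ℝ} (hz : 0 ≤ z) :
    P.integrand j z = (P.weight z - 1) ^ j * z := by
  have : P.r₀ ^ (-P.α) + P.γ * z ^ (-P.α) ≠ 0 := by positivity
  rw [integrand, weight, div_sub_one this]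
  congr 3
  ring

lemma measurable_integrand (P : Params) (j : ℕ) : Measurable (P.integrand j) := by
  unfold integrand
  fun_prop

lemma radialIntegral_eq_coe {j : ℕ} (h : IntegrableOn (P.integrand j) (Ioi 0)) :
    P.radialIntegral j = ((∫ z in Ioi (0 : ℝ), P.integrand j z : ℝ) : EReal) := by
  rw [radialIntegral, integral_eq_lintegral_pos_part_sub_lintegral_neg_part h, EReal.coe_sub,
    EReal.coe_ennreal_toReal, EReal.coe_ennreal_toReal]
  · exact ((lintegral_ofReal_le_lintegral_enorm _).trans_lt h.neg.2).ne
  · exact ((lintegral_ofReal_le_lintegral_enorm _).trans_lt h.2).ne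

/-- If the first integrand is integrable, so are the others: the factors are at most `1`. -/
lemma integrableOn_integrand (hγ : 0 < P.γ) (hr₀ : 0 < P.r₀)
    (h : IntegrableOn (P.integrand 1) (Ioi 0)) {j : ℕ} (hj : 1 ≤ j) :
    IntegrableOn (P.integrand j) (Ioi 0) := by
  refine Integrable.mono h (P.measurable_integrand j).aestronglyMeasurable ?_
  filter_upwards [ae_restrict_mem measurableSet_Ioi] with z hz
  have hz' : (0 : ℝ) ≤ z := (mem_Ioi.1 hz).le
  rw [integrand_eq hγ hr₀ _ hz', integrand_eq hγ hr₀ _ hz', norm_mul, norm_mul, norm_pow, norm_pow]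
  refine mul_le_mul_of_nonneg_right ?_ (norm_nonneg _)
  refine pow_le_pow_of_le_one (norm_nonneg _) ?_ hj
  rw [Real.norm_eq_abs, abs_le]
  constructor <;> linarith [weight_pos hγ hr₀ hz', weight_le_one hγ hr₀ hz']

lemma I_eq_coe_sum (hγ : 0 < P.γ) (hr₀ : 0 < P.r₀)
    (h : IntegrableOn (P.integrand 1) (Ioi 0)) (l : ℕ) :
    P.I l = ((∑ j ∈ Finset.Icc 1 l,
      (l.choose j : ℝ) * ∫ z in Ioi (0 : ℝ), P.integrand j z : ℝ) : EReal) := by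
  have hsum := fun f : ℕ → ℝ =>
    map_sum (⟨⟨Real.toEReal, rfl⟩, EReal.coe_add⟩ : ℝ →+ EReal) f (Finset.Icc 1 l)
  refine Eq.trans ?_ (hsum _).symm
  rw [I]
  refine Finset.sum_congr rfl fun j hj => ?_
  rw [radialIntegral_eq_coe (integrableOn_integrand hγ hr₀ h (Finset.mem_Icc.1 hj).1),
    ← EReal.coe_mul]
  rfl

lemma sum_choose_integrand (hγ : 0 < P.γ) (hr₀ : 0 < P.r₀) (l : ℕ) {z : ℝ} (hz : 0 ≤ z) :
    ∑ j ∈ Finset.Icc 1 l, (l.choose j : ℝ) * P.integrand j z = -((1 - P.weight z ^ l) * z) := by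
  have h := add_pow (P.weight z - 1) 1 l
  rw [Finset.sum_range_succ', sub_add_cancel] at h
  have hI : ∀ f : ℕ → ℝ, ∑ j ∈ Finset.Icc 1 l, f j = ∑ j ∈ Finset.range l, f (j + 1) := by
    intro f
    rw [Finset.range_eq_Ico, Finset.sum_Ico_add' f 0 l 1]
    exact Finset.sum_congr (by ext; simp [Order.lt_add_one_iff]) fun _ _ => rfl
  rw [hI, h]
  simp only [integrand_eq hγ hr₀ _ hz]
  simp only [one_pow, mul_one, pow_zero, Nat.choose_zero_right, Nat.cast_one]
  rw [show ∀ a : ℝ, -((1 - (a + 1)) * z) = a * z by intro a; ring, Finset.sum_mul]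
  exact Finset.sum_congr rfl fun j _ => by ring

/-- `I(l)` is minus a single radial integral, both where the integrals are finite and where they
are infinite. -/
theorem I_eq_neg_lintegral (hγ : 0 < P.γ) (hr₀ : 0 < P.r₀) (l : ℕ) :
    P.I l = -((∫⁻ z in Ioi (0 : ℝ), ENNReal.ofReal ((1 - P.weight z ^ l) * z) : ℝ≥0∞) : EReal) := by
  have hnn : ∀ z : ℝ, 0 ≤ z → 0 ≤ (1 - P.weight z ^ l) * z := fun z hz =>
    mul_nonneg (sub_nonneg.2 (pow_le_one₀ (weight_pos hγ hr₀ hz).le (weight_le_one hγ hr₀ hz))) hz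
  have hm : Measurable fun z => (1 - P.weight z ^ l) * z := by
    have := P.measurable_weight
    fun_prop
  rcases Nat.eq_zero_or_pos l with rfl | hl
  · simp [I]
  by_cases h : IntegrableOn (P.integrand 1) (Ioi 0)
  · have hint : ∀ j ∈ Finset.Icc 1 l, Integrable (fun z => (l.choose j : ℝ) * P.integrand j z)
        (volume.restrict (Ioi 0)) := fun j hj =>
      (integrableOn_integrand hγ hr₀ h (Finset.mem_Icc.1 hj).1).const_mul _
    have hae : (fun z => ∑ j ∈ Finset.Icc 1 l, (l.choose j : ℝ) * P.integrand j z)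
        =ᵐ[volume.restrict (Ioi 0)] fun z => -((1 - P.weight z ^ l) * z) := by
      filter_upwards [ae_restrict_mem measurableSet_Ioi] with z hz
      exact sum_choose_integrand hγ hr₀ l (mem_Ioi.1 hz).le
    have hint' : Integrable (fun z => (1 - P.weight z ^ l) * z) (volume.restrict (Ioi 0)) := by
      simpa using ((integrable_finsetSum _ hint).congr hae).neg
    rw [I_eq_coe_sum hγ hr₀ h, ← ofReal_integral_eq_lintegral_ofReal hint',
      EReal.coe_ennreal_ofReal,
      max_eq_left, ← EReal.coe_neg, ← integral_neg, ← integral_congr_ae hae,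
      integral_finsetSum _ hint]
    · simp_rw [integral_const_mul]
    · exact setIntegral_nonneg measurableSet_Ioi fun z hz => hnn z (mem_Ioi.1 hz).le
    · filter_upwards [ae_restrict_mem measurableSet_Ioi] with z hz
      exact hnn z (mem_Ioi.1 hz).le
  · have htop : ∫⁻ z in Ioi (0 : ℝ), ENNReal.ofReal (-P.integrand 1 z) = ⊤ := by
      by_contra hne
      refine h ?_
      have := (lintegral_ofReal_ne_top_iff_integrable (μ := volume.restrict (Ioi 0))
        (f := fun z => -P.integrand 1 z)
        (P.measurable_integrand 1).neg.aestronglyMeasurable ?_).1 hne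
      · simpa [IntegrableOn] using this.neg
      · filter_upwards [ae_restrict_mem measurableSet_Ioi] with z hz
        have hz' : (0 : ℝ) ≤ z := (mem_Ioi.1 hz).le
        rw [integrand_eq hγ hr₀ _ hz', pow_one, ← neg_mul]
        exact mul_nonneg (by linarith [weight_le_one hγ hr₀ hz']) hz'
    have hzero : ∫⁻ z in Ioi (0 : ℝ), ENNReal.ofReal (P.integrand 1 z) = 0 := by
      rw [setLIntegral_congr_fun (g := fun _ => 0) measurableSet_Ioi, lintegral_zero]
      intro z hz
      have hz' : (0 : ℝ) ≤ z := (mem_Ioi.1 hz).le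
      refine ENNReal.ofReal_of_nonpos ?_
      rw [integrand_eq hγ hr₀ _ hz', pow_one]
      exact mul_nonpos_of_nonpos_of_nonneg (by linarith [weight_le_one hγ hr₀ hz']) hz'
    have hge : ∫⁻ z in Ioi (0 : ℝ), ENNReal.ofReal ((1 - P.weight z ^ l) * z) = ⊤ := by
      refine top_le_iff.1 (htop.symm.le.trans (setLIntegral_mono' measurableSet_Ioi ?_))
      intro z hz
      have hz' : (0 : ℝ) ≤ z := (mem_Ioi.1 hz).le
      refine ENNReal.ofReal_le_ofReal ?_
      rw [integrand_eq hγ hr₀ _ hz', pow_one, ← neg_mul]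
      refine mul_le_mul_of_nonneg_right ?_ hz'
      have := pow_le_of_le_one (weight_pos hγ hr₀ hz').le (weight_le_one hγ hr₀ hz') hl.ne'
      linarith
    have hbot : P.radialIntegral 1 = ⊥ := by
      rw [radialIntegral, htop, hzero]
      simp
    rw [hge, I, ← Finset.add_sum_erase _ _ (Finset.mem_Icc.2 ⟨le_rfl, hl⟩), hbot,
      EReal.coe_mul_bot_of_pos (by exact_mod_cast Nat.choose_pos hl)]
    simp

/-- `ζ(l)` in terms of a plane integral. -/
theorem zeta_eq (hlam : 0 < P.lam) (hq0 : 0 ≤ P.q) (hγ : 0 < P.γ) (hr₀ : 0 < P.r₀) (l : ℕ) :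
    P.zeta l = Real.exp (-(P.γ * P.N₀ * l) / (P.η * P.ρ * P.r₀ ^ (-P.α))) *
      (negExp (ENNReal.ofReal P.lam *
        ∫⁻ y : Plane, ENNReal.ofReal (P.q * (1 - P.weight ‖y‖ ^ l)))).toReal := by
  have hm : Measurable fun z => ENNReal.ofReal (P.q * (1 - P.weight z ^ l)) := by
    have := P.measurable_weight
    fun_prop
  have hm' : Measurable fun z => ENNReal.ofReal ((1 - P.weight z ^ l) * z) := by
    have := P.measurable_weight
    fun_prop
  have h : ∫⁻ z in Ioi (0 : ℝ), ENNReal.ofReal z * ENNReal.ofReal (P.q * (1 - P.weight z ^ l)) =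
      ENNReal.ofReal P.q * ∫⁻ z in Ioi (0 : ℝ), ENNReal.ofReal ((1 - P.weight z ^ l) * z) := by
    rw [← lintegral_const_mul _ hm']
    refine setLIntegral_congr_fun measurableSet_Ioi fun z hz => ?_
    have hz' : (0 : ℝ) ≤ z := (mem_Ioi.1 hz).le
    rw [← ENNReal.ofReal_mul hz', ← ENNReal.ofReal_mul hq0]
    congr 1
    ring
  rw [zeta, I_eq_neg_lintegral hγ hr₀, lintegral_fun_norm_plane hm, h, negExp, mul_neg,
    ← mul_assoc, ← mul_assoc, ← ENNReal.ofReal_mul hlam.le, ← ENNReal.ofReal_mul (by positivity),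
    EReal.coe_ennreal_mul, EReal.coe_ennreal_ofReal, max_eq_left (by positivity)]
  congr 6
  ring

/-- For path-loss exponents above `2`, the first integrand is `O(z)` near zero and `O(z ^ (1 - α))`
at infinity. -/
lemma integrableOn_integrand_one (hγ : 0 < P.γ) (hr₀ : 0 < P.r₀) (hα : 2 < P.α) :
    IntegrableOn (P.integrand 1) (Ioi 0) := by
  rw [← Ioc_union_Ioi_eq_Ioi (zero_le_one (α := ℝ)), integrableOn_union]
  have habs : ∀ z : ℝ, 0 < z → ‖P.integrand 1 z‖ = (1 - P.weight z) * z := by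
    intro z hz
    rw [integrand_eq hγ hr₀ _ hz.le, pow_one, norm_mul, Real.norm_of_nonneg hz.le,
      Real.norm_of_nonpos (by linarith [weight_le_one hγ hr₀ hz.le]), neg_sub]
  constructor
  · refine Measure.integrableOn_of_bounded (M := 1) (by simp)
      (P.measurable_integrand 1).aestronglyMeasurable ?_
    filter_upwards [ae_restrict_mem measurableSet_Ioc] with z hz
    rw [habs z hz.1]
    have := weight_pos hγ hr₀ hz.1.le
    have := weight_le_one hγ hr₀ hz.1.le
    exact mul_le_one₀ (by linarith) hz.1.le hz.2
  · have hg : IntegrableOn (fun z : ℝ => P.γ / P.r₀ ^ (-P.α) * z ^ (1 - P.α)) (Ioi 1) :=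
      (integrableOn_Ioi_rpow_of_lt (by linarith) one_pos).const_mul _
    refine Integrable.mono hg (P.measurable_integrand 1).aestronglyMeasurable ?_
    filter_upwards [ae_restrict_mem measurableSet_Ioi] with z hz
    have hz0 : 0 < z := one_pos.trans (mem_Ioi.1 hz)
    rw [habs z hz0, Real.norm_of_nonneg (by positivity), Real.rpow_sub hz0, Real.rpow_one,
      weight, one_sub_div (by positivity), add_sub_cancel_left, Real.rpow_neg hz0.le]
    have hA : 0 < P.r₀ ^ (-P.α) := by positivity
    have hB : 0 < z ^ P.α := by positivity
    rw [div_mul_eq_mul_div, div_mul_div_comm, div_le_div_iff₀ (by positivity) (by positivity)]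
    field_simp
    nlinarith
end Params

end PoissonControl

namespace PoissonControl

/-! ### Independence and conditional probabilities -/

lemma measurable_pi_of_comap_le {Ω κ β : Type*} [MeasurableSpace β] {m : MeasurableSpace Ω}
    {X : κ → Ω → β} (h : ∀ k, MeasurableSpace.comap (X k) inferInstance ≤ m) :
    Measurable[m] fun ω k => X k ω :=
  measurable_pi_iff.2 fun k => (comap_measurable (X k)).mono (h k) le_rfl

variable {Ω β β' : Type*} [mΩ : MeasurableSpace Ω] {μ : Measure Ω}
  [MeasurableSpace β] [MeasurableSpace β']

/-- Disjoint groups of independent σ-algebras generate independent σ-algebras. -/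
lemma iIndep_biSup_of_pairwise_disjoint {ι κ : Type*} {m : ι → MeasurableSpace Ω}
    (hm : ∀ i, m i ≤ mΩ) (hind : iIndep m μ) {f : κ → Set ι}
    (hf : Pairwise (Function.onFun Disjoint f)) : iIndep (fun k => ⨆ i ∈ f k, m i) μ := by
  classical
  have := hind.isProbabilityMeasure
  rw [iIndep_iff]
  intro s
  induction s using Finset.induction_on with
  | empty => simp
  | insert a s ha ih =>
    intro B hB
    rw [Finset.set_biInter_insert, Finset.prod_insert ha,
      ← ih fun k hk => hB k (Finset.mem_insert_of_mem hk)]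
    have hdisj : Disjoint (f a) (⋃ k ∈ s, f k) := by
      rw [Set.disjoint_iUnion₂_right]
      intro k hk
      exact hf (by rintro rfl; exact ha hk)
    refine (Indep_iff _ _ _).1 (indep_iSup_of_disjoint hm hind hdisj) _ _
      (hB a (Finset.mem_insert_self a s)) (Finset.measurableSet_biInter _ fun k hk => ?_)
    have hle : (⨆ i ∈ f k, m i) ≤ ⨆ i ∈ ⋃ k ∈ s, f k, m i :=
      biSup_mono fun i hi => mem_biUnion hk hi
    exact hle _ (hB k (Finset.mem_insert_of_mem hk))

lemma lintegral_eq_lintegral_lintegral_of_indepFun [IsProbabilityMeasure μ] {X : Ω → β}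
    {Y : Ω → β'} (hX : Measurable X) (hY : Measurable Y) (h : IndepFun X Y μ)
    {F : β → β' → ℝ≥0∞} (hF : Measurable (Function.uncurry F)) :
    ∫⁻ ω, F (X ω) (Y ω) ∂μ = ∫⁻ ω, ∫⁻ ω', F (X ω) (Y ω') ∂μ ∂μ := by
  have : IsProbabilityMeasure (μ.map X) := Measure.isProbabilityMeasure_map hX.aemeasurable
  have : IsProbabilityMeasure (μ.map Y) := Measure.isProbabilityMeasure_map hY.aemeasurable
  have h1 := lintegral_map (μ := μ) hF (hX.prodMk hY)
  rw [(indepFun_iff_map_prod_eq_prod_map_map hX.aemeasurable hY.aemeasurable).1 h,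
    lintegral_prod _ hF.aemeasurable, lintegral_map hF.lintegral_prod_right' hX] at h1
  refine h1.symm.trans (lintegral_congr fun ω => ?_)
  exact lintegral_map (hF.comp measurable_prodMk_left) hY

/-- The probability that a standard exponential variable exceeds an independent threshold `Z` is the
Laplace transform of `Z` at `1`. -/
lemma measure_lt_of_indepFun_expMeasure [IsProbabilityMeasure μ] {Z : Ω → ℝ≥0∞} {X : Ω → ℝ}
    (hZ : Measurable Z) (hX : Measurable X) (h : IndepFun Z X μ)
    (hexp : μ.map X = expMeasure 1) :
    μ {ω | Z ω < ENNReal.ofReal (X ω)} = ∫⁻ ω, negExp (Z ω) ∂μ := by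
  have hS : MeasurableSet {p : ℝ≥0∞ × ℝ | p.1 < ENNReal.ofReal p.2} :=
    measurableSet_lt measurable_fst measurable_snd.ennreal_ofReal
  have hF : Measurable (Function.uncurry fun (z : ℝ≥0∞) (x : ℝ) =>
      {p : ℝ≥0∞ × ℝ | p.1 < ENNReal.ofReal p.2}.indicator (1 : ℝ≥0∞ × ℝ → ℝ≥0∞) (z, x)) :=
    measurable_one.indicator hS
  have h1 := lintegral_eq_lintegral_lintegral_of_indepFun hZ hX h hF
  have h2 : ∀ ω, ∫⁻ ω', {p : ℝ≥0∞ × ℝ | p.1 < ENNReal.ofReal p.2}.indicator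
      (1 : ℝ≥0∞ × ℝ → ℝ≥0∞) (Z ω, X ω') ∂μ = negExp (Z ω) := fun ω => by
    rw [← measure_lt_of_map_eq_expMeasure hX hexp, ← lintegral_indicator_one]
    · rfl
    · exact measurableSet_lt measurable_const hX.ennreal_ofReal
  simp_rw [h2] at h1
  rw [← h1, ← lintegral_indicator_one (measurableSet_lt hZ hX.ennreal_ofReal)]
  rfl

/-- Conditioning on `X` an event that involves an independent variable `Y` amounts to freezing the
value of `X`. -/
lemma condExp_indicator_of_indepFun [IsProbabilityMeasure μ] {X : Ω → β} {Y : Ω → β'}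
    (hX : Measurable X) (hY : Measurable Y) (h : IndepFun X Y μ) {S : Set (β × β')}
    (hS : MeasurableSet S) :
    μ⟦{ω | (X ω, Y ω) ∈ S} | MeasurableSpace.comap X inferInstance⟧ =ᵐ[μ]
      fun ω => μ.real {ω' | (X ω, Y ω') ∈ S} := by
  have : IsProbabilityMeasure (μ.map X) := Measure.isProbabilityMeasure_map hX.aemeasurable
  have : IsProbabilityMeasure (μ.map Y) := Measure.isProbabilityMeasure_map hY.aemeasurable
  have hmeas : MeasurableSet {ω | (X ω, Y ω) ∈ S} := (hX.prodMk hY) hS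
  set g : β → ℝ≥0∞ := fun x => μ.map Y (Prod.mk x ⁻¹' S) with hg
  have hgm : Measurable g := measurable_measure_prodMk_left hS
  have hgX : ∀ ω, μ.real {ω' | (X ω, Y ω') ∈ S} = (g (X ω)).toReal := fun ω => by
    rw [hg]
    dsimp only
    rw [Measure.map_apply hY (measurable_prodMk_left hS)]
    rfl
  have hle : ∀ x, g x ≤ 1 := fun x => prob_le_one
  simp_rw [hgX]
  have hgXm : Measurable[MeasurableSpace.comap X inferInstance] fun ω => (g (X ω)).toReal :=
    (hgm.ennreal_toReal).comp (comap_measurable X)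
  have hint : Integrable (fun ω => (g (X ω)).toReal) μ :=
    integrable_toReal_of_lintegral_ne_top (hgm.comp hX).aemeasurable
      (((lintegral_mono fun ω => hle (X ω)).trans_lt (by simp)).ne)
  refine (ae_eq_condExp_of_forall_setIntegral_eq hX.comap_le
    ((integrable_const (1 : ℝ)).indicator hmeas) (fun _ _ _ => hint.integrableOn) ?_
    hgXm.stronglyMeasurable.aestronglyMeasurable).symm
  rintro _ ⟨B, hB, rfl⟩ -
  rw [integral_toReal (f := fun ω => g (X ω)) (hgm.comp hX).aemeasurable (ae_of_all _ fun ω =>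
    (hle (X ω)).trans_lt ENNReal.one_lt_top), integral_indicator_const _ hmeas, smul_eq_mul,
    mul_one, Measure.real, Measure.restrict_apply hmeas]
  congr 1
  have hBS : MeasurableSet (S ∩ B ×ˢ univ) := hS.inter (hB.prod .univ)
  have h1 : μ ({ω | (X ω, Y ω) ∈ S} ∩ X ⁻¹' B) = μ.map (fun ω => (X ω, Y ω)) (S ∩ B ×ˢ univ) := by
    rw [Measure.map_apply (hX.prodMk hY) hBS]
    congr 1
    ext ω
    simp
  rw [h1, (indepFun_iff_map_prod_eq_prod_map_map hX.aemeasurable hY.aemeasurable).1 h,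
    Measure.prod_apply hBS, ← setLIntegral_map hB hgm hX, ← lintegral_indicator hB]
  refine lintegral_congr fun x => ?_
  by_cases hx : x ∈ B
  · rw [indicator_of_mem hx, hg]
    dsimp only
    congr 1
    ext y
    simp [hx]
  · rw [indicator_of_notMem hx]
    have : Prod.mk x ⁻¹' (S ∩ B ×ˢ univ) = ∅ := by
      ext y
      simp [hx]
    rw [this, measure_empty]


/-- Conditioning a measure on an event independent of `X` does not change the law of `X`. -/
lemma map_cond_eq_of_indep [IsProbabilityMeasure μ] {X : Ω → β}
    (hX : Measurable X) {A : Set Ω} (hA : MeasurableSet A) (hA0 : μ A ≠ 0)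
    (h : ∀ B, MeasurableSet B → μ (A ∩ X ⁻¹' B) = μ A * μ (X ⁻¹' B)) :
    (ProbabilityTheory.cond μ A).map X = μ.map X := by
  ext B hB
  rw [Measure.map_apply hX hB, Measure.map_apply hX hB, cond_apply hA, h B hB, ← mul_assoc,
    ENNReal.inv_mul_cancel hA0 (measure_ne_top _ _), one_mul]

end PoissonControl

namespace PoissonControl

/-! ### The success event and its conditional probability -/

/-- A realization of the network as seen by the typical pair within one block: the locations of all
controllers, and the activities of the interfering controllers. -/
abbrev Environment : Type := (ℕ → Plane) × (ℕ → Bool)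

namespace Params

variable (P : Params)

/-- The pairs of an environment and a vector of fading coefficients for which the transmission of
the typical controller succeeds. -/
def successSet : Set (Environment × (ℕ → ℂ)) :=
  {x | ENNReal.ofReal P.γ * (ENNReal.ofReal P.N₀ + ∑' i, if x.1.2 i = true then
      ENNReal.ofReal (P.η * P.ρ * ‖x.2 (i + 1)‖ ^ 2 * ‖x.1.1 (i + 1)‖ ^ (-P.α)) else 0) <
    ENNReal.ofReal (P.η * P.ρ * ‖x.2 0‖ ^ 2 * P.r₀ ^ (-P.α))}

/-- Minus the logarithm of the success probability in a given environment. -/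
noncomputable def successExponent (e : Environment) : ℝ≥0∞ :=
  ENNReal.ofReal (P.γ * P.N₀ / (P.η * P.ρ * P.r₀ ^ (-P.α))) +
    ∑' i, if e.2 i = true then negLog (ENNReal.ofReal (P.weight ‖e.1 (i + 1)‖)) else 0

/-- The success probability in a given environment. -/
noncomputable def successProb (e : Environment) : ℝ := (negExp (P.successExponent e)).toReal

lemma measurableSet_successSet : MeasurableSet P.successSet := by
  refine measurableSet_lt ?_ (by fun_prop)
  refine Measurable.const_mul (Measurable.const_add (Measurable.tsum fun i => ?_) _) _
  refine Measurable.ite ?_ (by fun_prop) measurable_const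
  exact measurableSet_eq_fun ((measurable_pi_apply i).comp (measurable_snd.comp measurable_fst))
    measurable_const

lemma measurable_successExponent : Measurable P.successExponent := by
  refine Measurable.const_add (Measurable.tsum fun i => ?_) _
  refine Measurable.ite ?_ ?_ measurable_const
  · exact measurableSet_eq_fun ((measurable_pi_apply i).comp measurable_snd) measurable_const
  · have := P.measurable_weight
    exact measurable_negLog.comp (by fun_prop)

lemma measurable_successProb : Measurable P.successProb :=
  (measurable_negExp.comp P.measurable_successExponent).ennreal_toReal

lemma successProb_nonneg (e : Environment) : 0 ≤ P.successProb e := ENNReal.toReal_nonneg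

lemma successProb_le_one (e : Environment) : P.successProb e ≤ 1 :=
  ENNReal.toReal_le_of_le_ofReal zero_le_one (by simpa using negExp_le_one _)

variable {P}

/-- Dividing the SINR inequality by the mean received power turns it into a lower bound for the
exponential variable `‖h 0‖ ^ 2`. -/
lemma mem_successSet_iff (hρ : 0 < P.ρ) (hη : 0 < P.η) (hγ : 0 < P.γ) (hr₀ : 0 < P.r₀)
    (e : Environment) (h : ℕ → ℂ) :
    (e, h) ∈ P.successSet ↔
      ENNReal.ofReal (P.γ * P.N₀ / (P.η * P.ρ * P.r₀ ^ (-P.α))) + (∑' i, if e.2 i = true then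
        ENNReal.ofReal (P.γ * ‖e.1 (i + 1)‖ ^ (-P.α) / P.r₀ ^ (-P.α) * ‖h (i + 1)‖ ^ 2) else 0) <
      ENNReal.ofReal (‖h 0‖ ^ 2) := by
  have hA : 0 < P.r₀ ^ (-P.α) := by positivity
  have hc : 0 < P.η * P.ρ * P.r₀ ^ (-P.α) := by positivity
  have h1 : ENNReal.ofReal (P.η * P.ρ * ‖h 0‖ ^ 2 * P.r₀ ^ (-P.α)) =
      ENNReal.ofReal (P.η * P.ρ * P.r₀ ^ (-P.α)) * ENNReal.ofReal (‖h 0‖ ^ 2) := by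
    rw [← ENNReal.ofReal_mul hc.le]
    congr 1
    ring
  have h2 : ENNReal.ofReal P.γ * (ENNReal.ofReal P.N₀ + ∑' i, if e.2 i = true then
      ENNReal.ofReal (P.η * P.ρ * ‖h (i + 1)‖ ^ 2 * ‖e.1 (i + 1)‖ ^ (-P.α)) else 0) =
      ENNReal.ofReal (P.η * P.ρ * P.r₀ ^ (-P.α)) *
        (ENNReal.ofReal (P.γ * P.N₀ / (P.η * P.ρ * P.r₀ ^ (-P.α))) + ∑' i, if e.2 i = true then
        ENNReal.ofReal (P.γ * ‖e.1 (i + 1)‖ ^ (-P.α) / P.r₀ ^ (-P.α) * ‖h (i + 1)‖ ^ 2) else 0) := by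
    rw [mul_add, mul_add, ← ENNReal.ofReal_mul hγ.le, ← ENNReal.ofReal_mul hc.le,
      ← ENNReal.tsum_mul_left, ← ENNReal.tsum_mul_left]
    congr 2
    · field_simp
    · funext i
      split_ifs
      · rw [← ENNReal.ofReal_mul hγ.le, ← ENNReal.ofReal_mul hc.le]
        congr 1
        field_simp
      · simp
  rw [successSet, mem_ofPred_eq]
  dsimp only
  rw [h1, h2, ENNReal.mul_lt_mul_iff_right (by simpa using hc) ENNReal.ofReal_ne_top]

/-- The success probability in a given environment, for independent Rayleigh fading. -/
lemma measureReal_mem_successSet (hρ : 0 < P.ρ) (hη : 0 < P.η)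
    (hγ : 0 < P.γ) (hr₀ : 0 < P.r₀) {Ω : Type*} [MeasurableSpace Ω] {μ : Measure Ω}
    [IsProbabilityMeasure μ] {h : ℕ → Ω → ℂ} (hm : ∀ i, Measurable (h i))
    (hexp : ∀ i, μ.map (fun ω => ‖h i ω‖ ^ 2) = expMeasure 1) (hind : iIndepFun h μ)
    (e : Environment) :
    μ.real {ω | (e, fun i => h i ω) ∈ P.successSet} = P.successProb e := by
  set c : ℕ → ℝ := fun i => P.γ * ‖e.1 (i + 1)‖ ^ (-P.α) / P.r₀ ^ (-P.α) with hc
  have hA : 0 < P.r₀ ^ (-P.α) := by positivity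
  have hc0 : ∀ i, 0 ≤ c i := fun i => by positivity
  set Z : ℕ → Ω → ℝ≥0∞ := fun i ω =>
    if e.2 i = true then ENNReal.ofReal (c i * ‖h (i + 1) ω‖ ^ 2) else 0 with hZ
  have hZc : ∀ i, ∃ g : ℂ → ℝ≥0∞, Measurable g ∧ Z i = g ∘ h (i + 1) := fun i => by
    refine ⟨fun z => if e.2 i = true then ENNReal.ofReal (c i * ‖z‖ ^ 2) else 0, ?_, rfl⟩
    split_ifs <;> fun_prop
  choose g hg hZg using hZc
  have hZm : ∀ i, Measurable (Z i) := fun i => hZg i ▸ (hg i).comp (hm _)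
  have hX : Measurable fun ω => ‖h 0 ω‖ ^ 2 := by have := hm 0; fun_prop
  have hZind : iIndepFun Z μ := by
    have := (hind.precomp (add_left_injective 1)).comp g hg
    rwa [show Z = fun i => g i ∘ h (i + 1) from funext hZg]
  have hZX : IndepFun (fun ω => ENNReal.ofReal (P.γ * P.N₀ / (P.η * P.ρ * P.r₀ ^ (-P.α))) +
      ∑' i, Z i ω) (fun ω => ‖h 0 ω‖ ^ 2) μ := by
    have hdisj : Disjoint (Ioi (0 : ℕ)) {0} := by simp
    have := indep_iSup_of_disjoint (fun i => (hm i).comap_le) hind.iIndep hdisj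
    rw [IndepFun_iff_Indep]
    refine indep_of_indep_of_le_left (indep_of_indep_of_le_right this ?_) ?_
    · refine Measurable.comap_le ?_
      have h0 : Measurable[⨆ i ∈ ({0} : Set ℕ), MeasurableSpace.comap (h i) inferInstance] (h 0) :=
        (comap_measurable (h 0)).mono (le_biSup (fun i => MeasurableSpace.comap (h i) _) rfl) le_rfl
      exact (measurable_norm.comp h0).pow_const 2
    · have hG : Measurable fun v : ℕ → ℂ =>
          ENNReal.ofReal (P.γ * P.N₀ / (P.η * P.ρ * P.r₀ ^ (-P.α))) + ∑' i, g i (v i) :=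
        Measurable.const_add (Measurable.tsum fun i => (hg i).comp (measurable_pi_apply i)) _
      have h0 : Measurable[⨆ i ∈ Ioi (0 : ℕ), MeasurableSpace.comap (h i) inferInstance]
          fun ω i => h (i + 1) ω :=
        measurable_pi_of_comap_le fun i =>
          le_biSup (fun i => MeasurableSpace.comap (h i) _) (Nat.succ_pos i)
      simp_rw [hZg]
      exact (hG.comp h0).comap_le
  have hone : ∀ i, ∫⁻ ω, negExp (Z i ω) ∂μ =
      negExp (if e.2 i = true then negLog (ENNReal.ofReal (P.weight ‖e.1 (i + 1)‖)) else 0) := by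
    intro i
    by_cases hi : e.2 i = true
    · simp only [hZ, hi, if_true]
      have hX' : Measurable fun ω => ‖h (i + 1) ω‖ ^ 2 := by have := hm (i + 1); fun_prop
      rw [lintegral_negExp_mul_of_map_eq_expMeasure hX' (hexp _) (hc0 i), negExp_negLog, weight, hc]
      · congr 1
        field_simp
      · rw [← ENNReal.ofReal_one]
        exact ENNReal.ofReal_le_ofReal (weight_le_one hγ hr₀ (norm_nonneg _))
    · simp [hZ, hi]
  have hset : {ω | (e, fun i => h i ω) ∈ P.successSet} =
      {ω | ENNReal.ofReal (P.γ * P.N₀ / (P.η * P.ρ * P.r₀ ^ (-P.α))) + ∑' i, Z i ω <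
        ENNReal.ofReal (‖h 0 ω‖ ^ 2)} := by
    ext ω
    exact mem_successSet_iff hρ hη hγ hr₀ e fun i => h i ω
  rw [Measure.real, hset, measure_lt_of_indepFun_expMeasure
    (Measurable.const_add (Measurable.tsum hZm) _) hX hZX (hexp 0), successProb, successExponent,
    negExp_add]
  simp_rw [negExp_add]
  rw [lintegral_const_mul' _ _ (negExp_ne_top _),
    lintegral_negExp_tsum hZm hZind hone]

/-- The moments of the success probability over the locations of the controllers and the
activities of the interfering ones. -/
lemma integral_successProb_pow (hlam : 0 < P.lam) (hq0 : 0 ≤ P.q) (hq1 : P.q ≤ 1) (hρ : 0 < P.ρ)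
    (hη : 0 < P.η) (hN₀ : 0 ≤ P.N₀) (hγ : 0 < P.γ) (hr₀ : 0 < P.r₀)
    {Ω : Type*} [MeasurableSpace Ω] {μ : Measure Ω} [IsProbabilityMeasure μ]
    {x : Ω → ℕ → Plane} {a : Ω → ℕ → Bool} (hxm : Measurable x) (ham : Measurable a)
    (hx : IsPoissonPointProcess μ P.lam fun i ω => x ω (i + 1))
    (ha : ∀ i, μ.real {ω | a ω i = true} = P.q) (hind : iIndepFun (fun i ω => a ω i) μ)
    (hxa : IndepFun x a μ) (l : ℕ) :
    ∫ ω, P.successProb (x ω, a ω) ^ l ∂μ = P.zeta l := by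
  have hA : 0 < P.r₀ ^ (-P.α) := by positivity
  set K : ℝ := P.γ * P.N₀ / (P.η * P.ρ * P.r₀ ^ (-P.α)) with hK
  have hK0 : 0 ≤ K := by positivity
  set φ : Plane → ℝ≥0∞ := fun y => l * negLog (ENNReal.ofReal (P.weight ‖y‖)) with hφ
  have hφm : Measurable φ := by
    have := P.measurable_weight
    exact measurable_const.mul (measurable_negLog.comp (by fun_prop))
  have hw0 : ∀ y : Plane, 0 < P.weight ‖y‖ := fun y => weight_pos hγ hr₀ (norm_nonneg y)
  have hw1 : ∀ y : Plane, P.weight ‖y‖ ≤ 1 := fun y => weight_le_one hγ hr₀ (norm_nonneg y)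
  have hwl : ∀ y : Plane, 0 ≤ P.q * (1 - P.weight ‖y‖ ^ l) ∧ P.q * (1 - P.weight ‖y‖ ^ l) ≤ 1 := by
    intro y
    have h1 : P.weight ‖y‖ ^ l ≤ 1 := pow_le_one₀ (hw0 y).le (hw1 y)
    have h2 : 0 ≤ P.weight ‖y‖ ^ l := (pow_pos (hw0 y) l).le
    exact ⟨mul_nonneg hq0 (by linarith), mul_le_one₀ hq1 (by linarith) (by linarith)⟩
  have hexpφ : ∀ y, negExp (φ y) = ENNReal.ofReal (P.weight ‖y‖ ^ l) := fun y => by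
    rw [hφ]
    dsimp only
    rw [← negExp_pow, negExp_negLog, ENNReal.ofReal_pow (hw0 y).le]
    exact ENNReal.ofReal_le_one.2 (hw1 y)
  set f : Plane → ℝ≥0∞ := fun y =>
    negLog (ENNReal.ofReal (1 - P.q * (1 - P.weight ‖y‖ ^ l))) with hf
  have hfm : Measurable f := by
    have := P.measurable_weight
    exact measurable_negLog.comp (by fun_prop)
  have hexpf : ∀ y, negExp (f y) = ENNReal.ofReal (1 - P.q * (1 - P.weight ‖y‖ ^ l)) := fun y =>
    negExp_negLog (ENNReal.ofReal_le_one.2 (by linarith [(hwl y).1]))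
  have ham' : ∀ i, Measurable fun ω => a ω i := fun i => (measurable_pi_apply i).comp ham
  have haA : ∀ i, MeasurableSet {ω | a ω i = true} := fun i =>
    ham' i (measurableSet_singleton true)
  -- averaging over the activities, for fixed locations
  have hinner : ∀ y : ℕ → Plane, ∫⁻ ω, negExp (∑' i, if a ω i = true then φ (y (i + 1)) else 0) ∂μ =
      negExp (∑' i, f (y (i + 1))) := by
    intro y
    have hg : ∀ i, Measurable fun b : Bool => if b = true then φ (y (i + 1)) else 0 := fun i =>
      measurable_from_top
    refine lintegral_negExp_tsum (Z := fun i ω => if a ω i = true then φ (y (i + 1)) else 0)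
      (fun i => (hg i).comp (ham' i)) (hind.comp _ hg) fun i => ?_
    have hsplit : ∀ ω, negExp (if a ω i = true then φ (y (i + 1)) else 0) =
        {ω | a ω i = true}.indicator (fun _ => negExp (φ (y (i + 1)))) ω +
          {ω | a ω i = true}ᶜ.indicator (fun _ => 1) ω := by
      intro ω
      by_cases h : a ω i = true <;> simp [h]
    have hμA : μ {ω | a ω i = true} = ENNReal.ofReal P.q := by
      rw [← ha i, Measure.real, ENNReal.ofReal_toReal (measure_ne_top _ _)]
    simp_rw [hsplit]
    rw [lintegral_add_left (measurable_const.indicator (haA i)),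
      lintegral_indicator_const (haA i), lintegral_indicator_const (haA i).compl,
      prob_compl_eq_one_sub (haA i), hμA, hexpφ, hexpf, one_mul, ← ENNReal.ofReal_one,
      ← ENNReal.ofReal_sub _ hq0, ← ENNReal.ofReal_mul (pow_nonneg (hw0 _).le l),
      ← ENNReal.ofReal_add (mul_nonneg (pow_nonneg (hw0 _).le l) hq0) (by linarith)]
    congr 1
    ring
  have hFm : Measurable (Function.uncurry fun (y : ℕ → Plane) (b : ℕ → Bool) =>
      negExp (∑' i, if b i = true then φ (y (i + 1)) else 0)) := by
    refine measurable_negExp.comp (Measurable.tsum fun i => Measurable.ite ?_ ?_ measurable_const)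
    · exact measurableSet_eq_fun ((measurable_pi_apply i).comp measurable_snd) measurable_const
    · exact hφm.comp ((measurable_pi_apply _).comp measurable_fst)
  have hmain : ∫⁻ ω, negExp (l * P.successExponent (x ω, a ω)) ∂μ =
      ENNReal.ofReal (Real.exp (-(l * K))) * negExp (ENNReal.ofReal P.lam *
        ∫⁻ y : Plane, ENNReal.ofReal (P.q * (1 - P.weight ‖y‖ ^ l))) := by
    have h1 : ∀ ω, negExp (l * P.successExponent (x ω, a ω)) =
        ENNReal.ofReal (Real.exp (-(l * K))) *
          negExp (∑' i, if a ω i = true then φ (x ω (i + 1)) else 0) := by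
      intro ω
      rw [successExponent, mul_add, negExp_add, ← ENNReal.tsum_mul_left,
        ← negExp_ofReal (by positivity), ENNReal.ofReal_mul (Nat.cast_nonneg l),
        ENNReal.ofReal_natCast]
      simp_rw [mul_ite, mul_zero]
      rfl
    simp_rw [h1]
    rw [lintegral_const_mul' _ _ ENNReal.ofReal_ne_top,
      lintegral_eq_lintegral_lintegral_of_indepFun (F := fun y b =>
        negExp (∑' i, if b i = true then φ (y (i + 1)) else 0)) hxm ham hxa hFm]
    simp_rw [hinner]
    rw [hx.lintegral_negExp_tsum hlam.le hfm]
    congr 3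
    refine lintegral_congr fun y => ?_
    rw [hexpf, ← ENNReal.ofReal_one, ← ENNReal.ofReal_sub _ (by linarith [(hwl y).2]),
      sub_sub_cancel]
  have hpow : ∀ ω, P.successProb (x ω, a ω) ^ l =
      (negExp (l * P.successExponent (x ω, a ω))).toReal := fun ω => by
    rw [successProb, ← ENNReal.toReal_pow, negExp_pow]
  simp_rw [hpow]
  rw [integral_toReal, hmain, zeta_eq hlam hq0 hγ hr₀, ENNReal.toReal_mul,
    ENNReal.toReal_ofReal (Real.exp_pos _).le]
  · congr 3
    rw [hK]
    ring
  · exact (measurable_negExp.comp (measurable_const.mul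
      (P.measurable_successExponent.comp (hxm.prodMk ham)))).aemeasurable
  · exact ae_of_all _ fun ω => (negExp_ne_top _).lt_top

end Params

end PoissonControl

namespace PoissonControl

namespace Network

/-! ### The random network -/

variable {Ω : Type*} (N : Network Ω) (P : Params)

/-- The environment of block `k`. -/
def env (k : ℕ) (ω : Ω) : Environment := (fun i => N.pos i ω, fun i => N.active (i + 1) k ω)

/-- The fading coefficients, slot by slot. -/
def slotFading (ω : Ω) (t i : ℕ) : ℂ := N.fading i t ω

lemma environment_eq_comap (k : ℕ) :
    N.environment k = MeasurableSpace.comap (N.env k) inferInstance := by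
  have h : (inferInstance : MeasurableSpace Environment) =
      MeasurableSpace.comap Prod.fst (⨆ i, MeasurableSpace.comap (fun b => b i) inferInstance) ⊔
        MeasurableSpace.comap Prod.snd (⨆ i, MeasurableSpace.comap (fun b => b i) inferInstance) :=
    rfl
  rw [h, MeasurableSpace.comap_sup, MeasurableSpace.comap_comp, MeasurableSpace.comap_comp,
    MeasurableSpace.comap_iSup, MeasurableSpace.comap_iSup]
  simp_rw [MeasurableSpace.comap_comp]
  rfl

variable {N P}

/-- On the event that the typical controller transmits, success depends only on the environment and
on the fading in the slot. -/
lemma success_eq_one_iff (hγ : 0 < P.γ) {ω : Ω} (hω : ‖N.pos 0 ω‖ = P.r₀) {k t : ℕ}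
    (ht : t / P.T = k) :
    N.success P t ω = 1 ↔
      N.active 0 k ω = true ∧ (N.env k ω, N.slotFading ω t) ∈ P.successSet := by
  have hif : N.success P t ω = 1 ↔
      ENNReal.ofReal P.γ < (N.access P 0 t ω : ℝ≥0∞) * N.sinr P t ω := by
    rw [success]
    split_ifs with h <;> simp [h]
  rw [hif, access, ht]
  by_cases h : N.active 0 k ω = true
  · rw [if_pos h, Nat.cast_one, one_mul, sinr, ENNReal.lt_div_iff_mul_lt
      (Or.inr ENNReal.ofReal_ne_top) (Or.inr (by simpa using hγ))]
    simp only [h, true_and, Params.successSet, mem_ofPred_eq, power, hω, env, slotFading, access,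
      ht]
    have hterm : ∀ i, (((if N.active (i + 1) k ω = true then 1 else 0 : ℕ) : ℝ≥0∞) *
        ENNReal.ofReal (P.η * P.ρ * ‖N.fading (i + 1) t ω‖ ^ 2 *
          ‖N.pos (i + 1) ω‖ ^ (-P.α))) = if N.active (i + 1) k ω = true then
        ENNReal.ofReal (P.η * P.ρ * ‖N.fading (i + 1) t ω‖ ^ 2 *
          ‖N.pos (i + 1) ω‖ ^ (-P.α)) else 0 := fun i => by split_ifs <;> simp
    simp_rw [hterm]
  · simp [h]

/-- The pairs of an environment and a family of fading coefficients for which block `k` contains a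
run of at least `v` successes. -/
def runSet (P : Params) (v k : ℕ) : Set (Environment × (ℕ → ℕ → ℂ)) :=
  {x | ∃ s, s + v ≤ P.T ∧ ∀ τ < v, (x.1, x.2 (k * P.T + (s + τ))) ∈ P.successSet}

lemma measurableSet_slot (t : ℕ) :
    MeasurableSet {x : Environment × (ℕ → ℕ → ℂ) | (x.1, x.2 t) ∈ P.successSet} :=
  (measurable_fst.prodMk ((measurable_pi_apply t).comp measurable_snd)) P.measurableSet_successSet

lemma measurableSet_runSet (v k : ℕ) : MeasurableSet (runSet P v k) := by
  have : runSet P v k = ⋃ s, ⋃ (_ : s + v ≤ P.T), ⋂ τ, ⋂ (_ : τ < v),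
      {x : Environment × (ℕ → ℕ → ℂ) | (x.1, x.2 (k * P.T + (s + τ))) ∈ P.successSet} := by
    ext x
    simp [runSet]
  rw [this]
  exact MeasurableSet.iUnion fun s => MeasurableSet.iUnion fun _ =>
    MeasurableSet.iInter fun τ => MeasurableSet.iInter fun _ => measurableSet_slot _

lemma blockControllable_eq (hγ : 0 < P.γ) (hpos : ∀ ω, ‖N.pos 0 ω‖ = P.r₀) {v : ℕ} (hv : 1 ≤ v)
    (k : ℕ) : N.blockControllable P v k =
      {ω | N.active 0 k ω = true} ∩ {ω | (N.env k ω, N.slotFading ω) ∈ runSet P v k} := by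
  have hdiv : ∀ j, j < P.T → (k * P.T + j) / P.T = k := by
    intro j hj
    rw [mul_comm, Nat.mul_add_div (by omega), Nat.div_eq_of_lt hj, add_zero]
  have hkT : (k + 1) * P.T = k * P.T + P.T := by ring
  ext ω
  simp only [blockControllable, runSet, mem_inter_iff, mem_ofPred_eq]
  constructor
  · rintro ⟨s, hs1, hs2, h⟩
    obtain ⟨s, rfl⟩ := Nat.exists_eq_add_of_le hs1
    have h' : ∀ τ < v, N.active 0 k ω = true ∧
        (N.env k ω, N.slotFading ω (k * P.T + (s + τ))) ∈ P.successSet := by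
      intro τ hτ
      have := h τ hτ
      rwa [add_assoc, success_eq_one_iff hγ (hpos ω) (hdiv _ (by omega))] at this
    exact ⟨(h' 0 hv).1, s, by omega, fun τ hτ => (h' τ hτ).2⟩
  · rintro ⟨ha, s, hs, h⟩
    refine ⟨k * P.T + s, by omega, by omega, fun τ hτ => ?_⟩
    rw [add_assoc, success_eq_one_iff hγ (hpos ω) (hdiv _ (by omega))]
    exact ⟨ha, h τ hτ⟩

namespace IsBlockAloha

lemma measurable_pos_of_mem {S : Set (Unit ⊕ (ℕ × ℕ) ⊕ (ℕ × ℕ))} (hS : Sum.inl () ∈ S) :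
    Measurable[⨆ s ∈ S, N.sources s] fun ω i => N.pos i ω :=
  measurable_pi_of_comap_le fun i =>
    (le_iSup (fun i => MeasurableSpace.comap (N.pos i) inferInstance) i).trans
      (le_biSup N.sources hS)

lemma measurable_active_of_mem {S : Set (Unit ⊕ (ℕ × ℕ) ⊕ (ℕ × ℕ))} {k : ℕ}
    (hS : ∀ i, Sum.inr (Sum.inl (i + 1, k)) ∈ S) :
    Measurable[⨆ s ∈ S, N.sources s] fun ω i => N.active (i + 1) k ω :=
  measurable_pi_of_comap_le fun i => le_biSup N.sources (hS i)

lemma measurable_slotFading_of_mem {S : Set (Unit ⊕ (ℕ × ℕ) ⊕ (ℕ × ℕ))}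
    (hS : ∀ p, Sum.inr (Sum.inr p) ∈ S) :
    Measurable[⨆ s ∈ S, N.sources s] N.slotFading :=
  measurable_pi_of_comap_le (X := fun t ω => N.slotFading ω t) fun t =>
    Measurable.comap_le (measurable_pi_of_comap_le fun i => le_biSup N.sources (hS (i, t)))

lemma measurable_env_of_mem {S : Set (Unit ⊕ (ℕ × ℕ) ⊕ (ℕ × ℕ))} {k : ℕ} (h0 : Sum.inl () ∈ S)
    (hS : ∀ i, Sum.inr (Sum.inl (i + 1, k)) ∈ S) :
    Measurable[⨆ s ∈ S, N.sources s] (N.env k) :=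
  (measurable_pos_of_mem h0).prodMk (measurable_active_of_mem hS)

variable [mΩ : MeasurableSpace Ω] {μ : Measure Ω}

lemma sources_le (hN : N.IsBlockAloha P μ) (s : Unit ⊕ (ℕ × ℕ) ⊕ (ℕ × ℕ)) : N.sources s ≤ mΩ := by
  rcases s with _ | ⟨i, k⟩ | ⟨i, t⟩
  · exact iSup_le fun i => (hN.measurable_pos i).comap_le
  · exact (hN.measurable_active i k).comap_le
  · exact (hN.measurable_fading i t).comap_le

lemma indepFun (hN : N.IsBlockAloha P μ) {β β' : Type*} [MeasurableSpace β] [MeasurableSpace β']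
    {S S' : Set (Unit ⊕ (ℕ × ℕ) ⊕ (ℕ × ℕ))} (hS : Disjoint S S') {X : Ω → β} {Y : Ω → β'}
    (hX : Measurable[⨆ s ∈ S, N.sources s] X) (hY : Measurable[⨆ s ∈ S', N.sources s] Y) :
    IndepFun X Y μ :=
  (IndepFun_iff_Indep _ _ _).2 (indep_of_indep_of_le_left (indep_of_indep_of_le_right
    (indep_iSup_of_disjoint hN.sources_le hN.indep hS) hY.comap_le) hX.comap_le)

lemma measurable_env (hN : N.IsBlockAloha P μ) (k : ℕ) : Measurable (N.env k) :=
  (measurable_env_of_mem (mem_univ _) fun _ => mem_univ _).mono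
    (iSup₂_le fun s _ => hN.sources_le s) le_rfl

lemma measurable_slotFading (hN : N.IsBlockAloha P μ) : Measurable N.slotFading :=
  (measurable_slotFading_of_mem fun _ => mem_univ _).mono
    (iSup₂_le fun s _ => hN.sources_le s) le_rfl

lemma indepFun_env_slotFading (hN : N.IsBlockAloha P μ) (k : ℕ) :
    IndepFun (N.env k) N.slotFading μ := by
  refine hN.indepFun (S := {s | ∀ p, s ≠ Sum.inr (Sum.inr p)})
    (S' := {s | ∃ p, s = Sum.inr (Sum.inr p)}) ?_
    (measurable_env_of_mem (fun p => by simp) fun i p => by simp)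
    (measurable_slotFading_of_mem fun p => ⟨p, rfl⟩)
  rw [Set.disjoint_left]
  rintro s h ⟨p, rfl⟩
  exact h p rfl

/-- The transmission of the typical controller is independent of the environment and the fading. -/
lemma indepFun_active_zero (hN : N.IsBlockAloha P μ) (k : ℕ) :
    IndepFun (N.active 0 k) (fun ω => (N.env k ω, N.slotFading ω)) μ := by
  refine hN.indepFun (S := {Sum.inr (Sum.inl (0, k))}) (S' := {Sum.inr (Sum.inl (0, k))}ᶜ)
    disjoint_compl_right ?_ ?_
  · exact (comap_measurable (N.active 0 k)).mono 
      (le_biSup N.sources (mem_singleton (Sum.inr (Sum.inl (0, k))))) le_rfl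
  · exact (measurable_env_of_mem (by simp) fun i => by simp).prodMk
      (measurable_slotFading_of_mem fun p => by simp)

/-- The fading vectors of different slots are independent. -/
lemma iIndep_slotFading (hN : N.IsBlockAloha P μ) :
    iIndep (fun t => MeasurableSpace.comap (fun ω => N.slotFading ω t) inferInstance) μ := by
  refine iIndep_of_iIndep_of_le (iIndep_biSup_of_pairwise_disjoint hN.sources_le hN.indep
    (f := fun t => {s | ∃ i, s = Sum.inr (Sum.inr (i, t))}) ?_) fun t => ?_
  · intro t t' htt'
    rw [Function.onFun, Set.disjoint_left]
    rintro _ ⟨i, rfl⟩ ⟨j, hj⟩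
    simp only [Sum.inr.injEq, Prod.mk.injEq] at hj
    exact htt' hj.2
  · exact Measurable.comap_le (measurable_pi_of_comap_le fun i =>
      le_biSup N.sources (i := Sum.inr (Sum.inr (i, t))) ⟨i, rfl⟩)

lemma measureReal_slot (hN : N.IsBlockAloha P μ) [IsProbabilityMeasure μ] (hρ : 0 < P.ρ)
    (hη : 0 < P.η) (hγ : 0 < P.γ) (hr₀ : 0 < P.r₀) (e : Environment) (t : ℕ) :
    μ.real {ω | (e, N.slotFading ω t) ∈ P.successSet} = P.successProb e := by
  refine Params.measureReal_mem_successSet hρ hη hγ hr₀ (fun i => hN.measurable_fading i t)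
    (fun i => hN.rayleigh i t) ?_ e
  rw [iIndepFun_iff_iIndep]
  exact hN.indep.precomp (g := fun i : ℕ => Sum.inr (Sum.inr (i, t))) fun i j h => by simpa using h

lemma measureReal_runSet (hN : N.IsBlockAloha P μ) [IsProbabilityMeasure μ] (hρ : 0 < P.ρ)
    (hη : 0 < P.η) (hγ : 0 < P.γ) (hr₀ : 0 < P.r₀) {v : ℕ} (hv : 1 ≤ v) (k : ℕ)
    (e : Environment) :
    μ.real {ω | (e, N.slotFading ω) ∈ runSet P v k} =
      ∑ l ∈ Finset.Icc 1 ((P.T + 1) / (v + 1)),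
        (-1 : ℝ) ^ (l + 1) * ((P.T - l * v).choose (l - 1) : ℝ) *
          (P.successProb e ^ (l * v + 1) * (1 - P.successProb e) ^ (l - 1) +
            ((P.T : ℝ) - l * v + 1) / l *
              (P.successProb e ^ (l * v) * (1 - P.successProb e) ^ l)) := by
  have hm : ∀ t, MeasurableSpace.comap (fun ω => N.slotFading ω t) inferInstance ≤ mΩ :=
    fun t => ((measurable_pi_apply t).comp hN.measurable_slotFading).comap_le
  refine measureReal_run
    (m := fun s => MeasurableSpace.comap (fun ω => N.slotFading ω (k * P.T + s)) inferInstance)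
    (E := fun s => {ω | (e, N.slotFading ω (k * P.T + s)) ∈ P.successSet})
    (fun s => hm _) (hN.iIndep_slotFading.precomp (add_right_injective (k * P.T))) (fun s => ?_)
    (fun s => hN.measureReal_slot hρ hη hγ hr₀ e _) hv P.T
  exact ⟨Prod.mk e ⁻¹' P.successSet, measurable_prodMk_left P.measurableSet_successSet, rfl⟩

/-- Conditionally on the transmission of the typical controller and on the environment, the
probability of an event that involves the environment and the fading is obtained by freezing the
environment. -/
lemma condProb_ae_eq (hN : N.IsBlockAloha P μ) [IsProbabilityMeasure μ] (hq : 0 < P.q) (k : ℕ)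
    {B : Set Ω} {S : Set (Environment × (ℕ → ℕ → ℂ))} (hS : MeasurableSet S)
    (hB : ∀ ω, N.active 0 k ω = true → (ω ∈ B ↔ (N.env k ω, N.slotFading ω) ∈ S)) :
    (N.givenTransmits μ k)⟦B | N.environment k⟧ =ᵐ[μ]
      fun ω => μ.real {ω' | (N.env k ω, N.slotFading ω') ∈ S} := by
  have hA : MeasurableSet {ω | N.active 0 k ω = true} :=
    hN.measurable_active 0 k (measurableSet_singleton true)
  have hA0 : μ {ω | N.active 0 k ω = true} ≠ 0 := by
    intro h
    have := hN.access 0 k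
    rw [Measure.real, h] at this
    simp at this
    exact hq.ne this
  have hE := hN.measurable_env k
  have hH := hN.measurable_slotFading
  set ν := N.givenTransmits μ k with hν
  have : IsProbabilityMeasure ν := cond_isProbabilityMeasure hA0
  have hmap : ν.map (fun ω => (N.env k ω, N.slotFading ω)) =
      μ.map (fun ω => (N.env k ω, N.slotFading ω)) :=
    map_cond_eq_of_indep (hE.prodMk hH) hA hA0 fun C hC =>
      (hN.indepFun_active_zero k).measure_inter_preimage_eq_mul {true} C
        (measurableSet_singleton true) hC
  have hmapE : ν.map (N.env k) = μ.map (N.env k) := by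
    have := congrArg (Measure.map Prod.fst) hmap
    rwa [Measure.map_map measurable_fst (hE.prodMk hH),
      Measure.map_map measurable_fst (hE.prodMk hH)] at this
  have hmapH : ν.map N.slotFading = μ.map N.slotFading := by
    have := congrArg (Measure.map Prod.snd) hmap
    rwa [Measure.map_map measurable_snd (hE.prodMk hH),
      Measure.map_map measurable_snd (hE.prodMk hH)] at this
  have hind : IndepFun (N.env k) N.slotFading ν := by
    rw [indepFun_iff_map_prod_eq_prod_map_map hE.aemeasurable hH.aemeasurable, hmap, hmapE, hmapH]
    exact (indepFun_iff_map_prod_eq_prod_map_map hE.aemeasurable hH.aemeasurable).1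
      (hN.indepFun_env_slotFading k)
  have hsec : ∀ e, ν.real {ω' | (e, N.slotFading ω') ∈ S} =
      μ.real {ω' | (e, N.slotFading ω') ∈ S} := fun e => by
    have h := congrArg (fun ρ => ρ.real (Prod.mk e ⁻¹' S)) hmapH
    rwa [map_measureReal_apply hH (measurable_prodMk_left hS),
      map_measureReal_apply hH (measurable_prodMk_left hS)] at h
  -- the identity holds almost surely given the transmission
  have hνae : ν⟦B | N.environment k⟧ =ᵐ[ν]
      fun ω => μ.real {ω' | (N.env k ω, N.slotFading ω') ∈ S} := by
    have h1 : B.indicator (fun _ => (1 : ℝ)) =ᵐ[ν]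
        {ω | (N.env k ω, N.slotFading ω) ∈ S}.indicator fun _ => (1 : ℝ) := by
      filter_upwards [ae_cond_mem hA] with ω hω
      have := hB ω hω
      by_cases h : ω ∈ B
      · simp [h, this.1 h]
      · simp [h, this.not.1 h]
    refine (condExp_congr_ae h1).trans ?_
    rw [N.environment_eq_comap k]
    refine (condExp_indicator_of_indepFun hE hH hind hS).trans (ae_of_all _ fun ω => ?_)
    exact hsec _
  -- both sides are functions of the environment, whose law is not affected by the transmission
  have hleft : Measurable[MeasurableSpace.comap (N.env k) inferInstance]
      (ν⟦B | N.environment k⟧) := by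
    rw [N.environment_eq_comap k]
    exact stronglyMeasurable_condExp.measurable
  obtain ⟨f, hf, hfE⟩ := hleft.exists_eq_measurable_comp
  have hg : Measurable fun e => μ.real {ω' | (e, N.slotFading ω') ∈ S} := by
    have : IsProbabilityMeasure (μ.map N.slotFading) :=
      Measure.isProbabilityMeasure_map hH.aemeasurable
    have h := (measurable_measure_prodMk_left (ν := μ.map N.slotFading) hS).ennreal_toReal
    simp only [Measure.map_apply hH (measurable_prodMk_left hS)] at h
    exact h
  rw [hfE] at hνae ⊢
  have hset : MeasurableSet {e | f e = μ.real {ω' | (e, N.slotFading ω') ∈ S}} :=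
    measurableSet_eq_fun hf hg
  have h2 : ∀ᵐ e ∂(ν.map (N.env k)), f e = μ.real {ω' | (e, N.slotFading ω') ∈ S} :=
    (ae_map_iff hE.aemeasurable hset).2 hνae
  rw [hmapE] at h2
  exact (ae_map_iff hE.aemeasurable hset).1 h2

lemma integral_successProb_pow (hN : N.IsBlockAloha P μ) [IsProbabilityMeasure μ]
    (hlam : 0 < P.lam) (hq0 : 0 ≤ P.q) (hq1 : P.q ≤ 1) (hρ : 0 < P.ρ) (hη : 0 < P.η)
    (hN₀ : 0 ≤ P.N₀) (hγ : 0 < P.γ) (hr₀ : 0 < P.r₀) (k l : ℕ) :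
    ∫ ω, P.successProb (N.env k ω) ^ l ∂μ = P.zeta l := by
  refine Params.integral_successProb_pow (x := fun ω i => N.pos i ω)
    (a := fun ω i => N.active (i + 1) k ω) hlam hq0 hq1 hρ hη hN₀ hγ hr₀
    (measurable_fst.comp (hN.measurable_env k)) (measurable_snd.comp (hN.measurable_env k))
    hN.interferers (fun i => hN.access (i + 1) k) ?_ ?_ l
  · rw [iIndepFun_iff_iIndep]
    exact hN.indep.precomp (g := fun i : ℕ => Sum.inr (Sum.inl (i + 1, k)))
      fun i j h => by simpa using h
  · exact hN.indepFun (S := {Sum.inl ()}) (S' := {Sum.inl ()}ᶜ) disjoint_compl_right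
      (measurable_pos_of_mem (mem_singleton _)) (measurable_active_of_mem fun i => by simp)

end IsBlockAloha

end Network

lemma pow_mul_one_sub_pow (p : ℝ) (a n : ℕ) : p ^ a * (1 - p) ^ n =
    ∑ j ∈ Finset.range (n + 1), (n.choose j : ℝ) * (-1) ^ j * p ^ (a + j) := by
  rw [sub_eq_neg_add, add_pow, Finset.mul_sum]
  refine Finset.sum_congr rfl fun j _ => ?_
  rw [neg_pow, pow_add, one_pow]
  ring

namespace Network

variable {Ω : Type*} {N : Network Ω} {P : Params} [mΩ : MeasurableSpace Ω] {μ : Measure Ω}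

namespace IsBlockAloha

/-- The probability of a run of successes in block `k`, given the transmission. -/
lemma integral_run (hN : N.IsBlockAloha P μ) [IsProbabilityMeasure μ]
    (hlam : 0 < P.lam) (hq0 : 0 ≤ P.q) (hq1 : P.q ≤ 1) (hρ : 0 < P.ρ) (hη : 0 < P.η)
    (hN₀ : 0 ≤ P.N₀) (hγ : 0 < P.γ) (hr₀ : 0 < P.r₀) {v : ℕ} (hv : 1 ≤ v) (k : ℕ) :
    ∫ ω, μ.real {ω' | (N.env k ω, N.slotFading ω') ∈ runSet P v k} ∂μ =
      ∑ l ∈ Finset.Icc 1 ((P.T + 1) / (v + 1)),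
        (-1 : ℝ) ^ (l + 1) * ((P.T - l * v).choose (l - 1) : ℝ) *
          (∑ j ∈ Finset.range l,
              ((l - 1).choose j : ℝ) * (-1) ^ j * P.zeta (l * v + 1 + j) +
            ((P.T : ℝ) - l * v + 1) / l *
              ∑ j ∈ Finset.range (l + 1), (l.choose j : ℝ) * (-1) ^ j * P.zeta (l * v + j)) := by
  have hint : ∀ a, Integrable (fun ω => P.successProb (N.env k ω) ^ a) μ := fun a =>
    Integrable.of_bound
      ((P.measurable_successProb.comp (hN.measurable_env k)).pow_const a).aestronglyMeasurable 1
      (ae_of_all _ fun ω => by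
        rw [norm_pow, Real.norm_of_nonneg (P.successProb_nonneg _)]
        exact pow_le_one₀ (P.successProb_nonneg _) (P.successProb_le_one _))
  have hsum : ∀ (s : Finset ℕ) (c : ℕ → ℝ) (a : ℕ → ℕ),
      Integrable (fun ω => ∑ j ∈ s, c j * P.successProb (N.env k ω) ^ a j) μ ∧
      ∫ ω, ∑ j ∈ s, c j * P.successProb (N.env k ω) ^ a j ∂μ = ∑ j ∈ s, c j * P.zeta (a j) := by
    intro s c a
    refine ⟨integrable_finsetSum _ fun j _ => (hint _).const_mul _, ?_⟩
    rw [integral_finsetSum _ fun j _ => (hint _).const_mul _]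
    refine Finset.sum_congr rfl fun j _ => ?_
    rw [integral_const_mul,
      hN.integral_successProb_pow hlam hq0 hq1 hρ hη hN₀ hγ hr₀]
  simp_rw [hN.measureReal_runSet hρ hη hγ hr₀ hv, pow_mul_one_sub_pow]
  rw [integral_finsetSum]
  · refine Finset.sum_congr rfl fun l hl => ?_
    rw [integral_const_mul, integral_add (hsum _ _ _).1 ((hsum _ _ _).1.const_mul _),
      integral_const_mul, (hsum _ _ _).2, (hsum _ _ _).2,
      Nat.sub_add_cancel (Finset.mem_Icc.1 hl).1]
  · exact fun l _ => ((hsum _ _ _).1.add ((hsum _ _ _).1.const_mul _)).const_mul _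

/-- Total probability over the transmission of the typical controller. -/
lemma measureReal_blockControllable (hN : N.IsBlockAloha P μ) [IsProbabilityMeasure μ]
    (hγ : 0 < P.γ) {v : ℕ} (hv : 1 ≤ v) (k : ℕ) :
    μ.real (N.blockControllable P v k) =
      P.q * ∫ ω, μ.real {ω' | (N.env k ω, N.slotFading ω') ∈ runSet P v k} ∂μ := by
  have hE := hN.measurable_env k
  have hH := hN.measurable_slotFading
  have hS : MeasurableSet (runSet P v k) := measurableSet_runSet v k
  have hmeas : MeasurableSet {ω | (N.env k ω, N.slotFading ω) ∈ runSet P v k} :=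
    (hE.prodMk hH) hS
  rw [← integral_congr_ae (condExp_indicator_of_indepFun hE hH (hN.indepFun_env_slotFading k) hS),
    integral_condExp hE.comap_le, integral_indicator_const _ hmeas, smul_eq_mul, mul_one,
    ← hN.access 0 k, blockControllable_eq hγ hN.typical hv, Measure.real, Measure.real,
    Measure.real, ← ENNReal.toReal_mul]
  congr 1
  exact (hN.indepFun_active_zero k).measure_inter_preimage_eq_mul {true} (runSet P v k)
    (measurableSet_singleton true) hS

end IsBlockAloha

end Network

/-- The minimal polynomial of a nonempty real square matrix is not constant. -/
lemma RestlessSystem.one_le_horizon {n m : ℕ} (hn : 0 < n) (R : RestlessSystem n m) :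
    1 ≤ R.horizon := by
  have : Nonempty (Fin n) := ⟨⟨0, hn⟩⟩
  exact minpoly.natDegree_pos (Matrix.isIntegral R.A)

end PoissonControl

theorem mainTheorem1 {n m : ℕ} (hn : 0 < n) (R : PoissonControl.RestlessSystem n m)
    (P : PoissonControl.Params)
    (hlam : 0 < P.lam) (hq0 : 0 ≤ P.q) (hq1 : P.q ≤ 1) (hα : 0 < P.α) (hρ : 0 < P.ρ)
    (hη : 0 < P.η) (hN₀ : 0 ≤ P.N₀) (hγ : 0 < P.γ) (hr₀ : 0 < P.r₀)
    {Ω : Type*} [MeasurableSpace Ω] (μ : Measure Ω) [IsProbabilityMeasure μ]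
    (N : PoissonControl.Network Ω) (hN : N.IsBlockAloha P μ) (k v : ℕ) (hv : v = R.horizon) :
    μ.real (N.blockControllable P v k) = P.q * ∫ ω, N.condControllable P μ v k ω ∂μ ∧
    P.q * ∫ ω, N.condControllable P μ v k ω ∂μ =
      P.q * ∑ l ∈ Finset.Icc 1 ((P.T + 1) / (v + 1)),
        (-1 : ℝ) ^ (l + 1) * ((P.T - l * v).choose (l - 1) : ℝ) *
          (∑ j ∈ Finset.range l,
              ((l - 1).choose j : ℝ) * (-1) ^ j * P.zeta (l * v + 1 + j) +
            ((P.T : ℝ) - l * v + 1) / l *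
              ∑ j ∈ Finset.range (l + 1), (l.choose j : ℝ) * (-1) ^ j * P.zeta (l * v + j)) ∧
    (0 < P.q → ∀ t, k * P.T ≤ t → t < (k + 1) * P.T → ∀ l : ℕ,
      ∫ ω, N.condSuccess P μ k t ω ^ l ∂μ = P.zeta l) ∧
    (2 < P.α → ∀ l : ℕ, P.I l =
      ((∑ j ∈ Finset.Icc 1 l,
        (l.choose j : ℝ) * ∫ z in Ioi (0 : ℝ), P.integrand j z : ℝ) : EReal)) := by
  have hv1 : 1 ≤ v := hv ▸ R.one_le_horizon hn
  have hBC := hN.measureReal_blockControllable hγ hv1 k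
  -- for `q = 0` the conditional probability is degenerate, but it is multiplied by zero
  have hcond : P.q * ∫ ω, N.condControllable P μ v k ω ∂μ =
      P.q * ∫ ω, μ.real {ω' | (N.env k ω, N.slotFading ω') ∈
        PoissonControl.Network.runSet P v k} ∂μ := by
    rcases hq0.eq_or_lt with hq | hq
    · simp [← hq]
    · congr 1
      refine integral_congr_ae (hN.condProb_ae_eq hq k
        (PoissonControl.Network.measurableSet_runSet v k) fun ω hω => ?_)
      rw [PoissonControl.Network.blockControllable_eq hγ hN.typical hv1]
      exact ⟨fun h => h.2, fun h => ⟨hω, h⟩⟩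
  refine ⟨hBC.trans hcond.symm, ?_, fun hq t ht1 ht2 l => ?_, fun hα2 l => ?_⟩
  · rw [hcond, hN.integral_run hlam hq0 hq1 hρ hη hN₀ hγ hr₀ hv1]
  · have htk : t / P.T = k := Nat.div_eq_of_lt_le ht1 ht2
    have h := hN.condProb_ae_eq hq k (B := {ω | N.success P t ω = 1})
      (PoissonControl.Network.measurableSet_slot (P := P) t) fun ω hω => by
        refine (PoissonControl.Network.success_eq_one_iff hγ (hN.typical ω) htk).trans ?_
        exact ⟨fun h => h.2, fun h => ⟨hω, h⟩⟩
    rw [← hN.integral_successProb_pow hlam hq0 hq1 hρ hη hN₀ hγ hr₀ k l]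
    refine integral_congr_ae (h.mono fun ω hω => ?_)
    have hω' : N.condSuccess P μ k t ω = P.successProb (N.env k ω) :=
      hω.trans (hN.measureReal_slot hρ hη hγ hr₀ _ t)
    simp only [hω']
  · exact PoissonControl.Params.I_eq_coe_sum hγ hr₀
      (PoissonControl.Params.integrableOn_integrand_one hγ hr₀ hα2) l
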